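/- **Theorem 1.3.** Let $n\ge 1$. Join $z,z'\in\mathbb Z^n$ by an edge ($z\sim z'$) if their Euclidean distance is $1$, and for $F:\mathbb Z^n\to\mathbb Z$ put $\Delta F(z)=-2nF(z)+\sum_{z'\sim z}F(z')$. A *state* is a function $\phi:\mathbb Z^n\to\mathbb Z_{\ge 0}$. Toppling a vertex removes $2n$ grains from it and adds one grain to each of its neighbours; it is legal if the vertex has at least $2n$ grains. A relaxation is a finite or infinite sequence of legal topplings along which the number of grains at each vertex is eventually constant, and whose final configuration has at most $2n-1$ grains at every vertex. If $\phi(z)=\phi(z')=2n-1$ for some $z'\sim z$, then $W^z\phi$ denotes the result of a toppling at $z$ followed by the relaxation. For $v\in\mathbb Z^n\setminus\{0\}$ a state $\phi$ is *$v$-movable* if there is $z_0\in\mathbb Z^n$ such that $W^{z_0}\phi(z)=\phi(z+v)$ for all $z$, while it is not true that $\phi(z)=\phi(z+v)$ for all $z$; it is *movable* if it is $v$-movable for some $v\neq 0$. It is *periodic* if there is a sublattice $L\subset\mathbb Z^n$ of rank $n-1$ with $\phi(z)=\phi(z+p)$ for all $z\in\mathbb Z^n$, $p\in L$. It is *hyperplane-shaped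 of direction $q$* if there are constants $c_1,c_2$ with $\{z:\phi(z)\ne 2n-1\}\subset\{z: c_1\le q\cdot z\le c_2\}$. A *soliton of direction $q$* is a periodic movable state that is hyperplane-shaped of direction $q$. Let $q\in\mathbb Z^n$ be primitive (that is, $q\ne kq'$ for all integers $k>1$ and $q'\in\mathbb Z^n$), and let $\Psi(z)=\min(0,q\cdot z)$ and $D(\Psi)=\{z:\Delta\Psi(z)\neq 0\}$. Then: 1. Among all functions $G:\mathbb Z^n\to\mathbb Z$ such that $\Delta G\le 0$, $\Psi-k\le G\le\Psi$ for some $k\in\mathbb N$, and $G=\Psi$ outside the set of points at Euclidean distance at most $C$ from $D(\Psi)$ for some $C>0$, there is a pointwise minimal one, $\psi$ (the canonical husking of $\Psi$). 2. The function $\phi=2n-1+\Delta\psi$ is a state, and it is a soliton of direction $q$. 3. For every $v\in\mathbb Z^n$ with $q\cdot v=1$, the state $\phi$ is $v$-movable and $(-v)$-movable. 4. Every soliton of direction $q$ is a translate $z\mapsto\phi(z+w)$, $w\in\mathbb Z^n$, of $\phi$. -/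

import Mathlib

namespace Sandpile

/-- The lattice `ℤⁿ`. -/
abbrev Lattice (n : ℕ) : Type := Fin n → ℤ

/-- Two lattice points are joined by an edge iff their Euclidean distance is one. -/
def Adj {n : ℕ} (z z' : Lattice n) : Prop := ∑ i, (z i - z' i) ^ 2 = 1

/-- The discrete Laplacian `ΔF(z) = -2n F(z) + ∑_{z' ∼ z} F(z')`; the neighbours of `z` are
`z + eᵢ` and `z - eᵢ`. -/
def laplacian {n : ℕ} (F : Lattice n → ℤ) (z : Lattice n) : ℤ :=
  -(2 * (n : ℤ)) * F z + ∑ i, (F (z + Pi.single i 1) + F (z - Pi.single i 1))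

/-! ### Topplings, relaxation and waves -/

open Classical in
/-- Toppling at `x`: `x` loses `2n` grains and each neighbour of `x` gains one grain. Values are
integers because the first toppling of a wave makes one value negative for a moment. -/
noncomputable def topple {n : ℕ} (σ : Lattice n → ℤ) (x : Lattice n) : Lattice n → ℤ :=
  fun z => σ z - (if z = x then 2 * (n : ℤ) else 0) + (if Adj x z then 1 else 0)

/-- The configurations passed through when the topplings prescribed by `s` are done one after
another, starting from `σ`; `s m = none` means that nothing is done at time `m`. -/
noncomputable def run {n : ℕ} (σ : Lattice n → ℤ) (s : ℕ → Option (Lattice n)) :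
    ℕ → Lattice n → ℤ
  | 0 => σ
  | m + 1 => match s m with
    | none => run σ s m
    | some x => topple (run σ s m) x

/-- `τ` is the result of the relaxation of `σ`: there is a finite or infinite sequence of legal
topplings (each one at a vertex that has at least `2n` grains at that time) starting from `σ` along
which the number of grains at each vertex is eventually constant, with final value `τ`, and no
legal toppling is possible in `τ`. -/
def RelaxesTo {n : ℕ} (σ τ : Lattice n → ℤ) : Prop :=
  ∃ s : ℕ → Option (Lattice n),
    (∀ m x, s m = some x → 2 * (n : ℤ) ≤ run σ s m x) ∧
    (∀ z, ∃ M, ∀ m, M ≤ m → run σ s m z = τ z) ∧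
    (∀ z, τ z ≤ 2 * (n : ℤ) - 1)

/-- `φ' = W^z φ`: the vertex `z` and one of its neighbours have `2n - 1` grains in `φ`, and `φ'` is
obtained from `φ` by a toppling at `z` followed by the relaxation. -/
def IsWave {n : ℕ} (z : Lattice n) (φ φ' : Lattice n → ℕ) : Prop :=
  (φ z : ℤ) = 2 * n - 1 ∧ (∃ z', Adj z z' ∧ (φ z' : ℤ) = 2 * n - 1) ∧
    RelaxesTo (topple (fun y => (φ y : ℤ)) z) (fun y => (φ' y : ℤ))

/-- `φ` is `v`-movable: some wave translates `φ` by `v`, and `φ` is not `v`-periodic. -/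
def IsMovableBy {n : ℕ} (v : Lattice n) (φ : Lattice n → ℕ) : Prop :=
  (∃ z₀, IsWave z₀ φ (fun z => φ (z + v))) ∧ ¬ ∀ z, φ z = φ (z + v)

/-- `φ` is movable: it is `v`-movable for some nonzero `v`. -/
def IsMovable {n : ℕ} (φ : Lattice n → ℕ) : Prop := ∃ v : Lattice n, v ≠ 0 ∧ IsMovableBy v φ

/-- `φ` is `L`-periodic for some sublattice `L` of rank `n - 1`. -/
def IsPeriodic {n : ℕ} (φ : Lattice n → ℕ) : Prop :=
  ∃ L : Submodule ℤ (Lattice n), Module.finrank ℤ L + 1 = n ∧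
    ∀ z, ∀ p ∈ L, φ z = φ (z + p)

/-- `φ` is hyperplane-shaped of direction `q`: the points where `φ` differs from `2n - 1` lie
between two hyperplanes orthogonal to `q`. -/
def IsHyperplaneShaped {n : ℕ} (q : Lattice n) (φ : Lattice n → ℕ) : Prop :=
  ∃ c₁ c₂ : ℤ, ∀ z, (φ z : ℤ) ≠ 2 * n - 1 → c₁ ≤ q ⬝ᵥ z ∧ q ⬝ᵥ z ≤ c₂

/-- A soliton of direction `q`: a periodic hyperplane-shaped movable state. -/
def IsSoliton {n : ℕ} (q : Lattice n) (φ : Lattice n → ℕ) : Prop :=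
  IsPeriodic φ ∧ IsHyperplaneShaped q φ ∧ IsMovable φ

/-- `q` is not a multiple `k q'` with an integer `k > 1`. -/
def IsPrimitive {n : ℕ} (q : Lattice n) : Prop :=
  ¬ ∃ (k : ℤ) (q' : Lattice n), 1 < k ∧ q = k • q'

/-! ### Huskings -/

/-- The deviation set of `F`: the points where `F` is not harmonic. -/
def deviationSet {n : ℕ} (F : Lattice n → ℤ) : Set (Lattice n) := {z | laplacian F z ≠ 0}

/-- The points at Euclidean distance at most `C` from `A` (for `C ≥ 0`). -/
def neighborhood {n : ℕ} (C : ℝ) (A : Set (Lattice n)) : Set (Lattice n) :=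
  {z | ∃ a ∈ A, ((∑ i, (z i - a i) ^ 2 : ℤ) : ℝ) ≤ C ^ 2}

/-- `Θ_k(F)`: the integer-valued superharmonic `G` with `F - k ≤ G ≤ F` that coincide with `F`
outside a finite neighbourhood of the deviation set of `F`. -/
def Theta {n : ℕ} (k : ℕ) (F : Lattice n → ℤ) : Set (Lattice n → ℤ) :=
  {G | (∀ z, laplacian G z ≤ 0) ∧ (∀ z, F z - k ≤ G z ∧ G z ≤ F z) ∧
    ∃ C : ℝ, 0 < C ∧ {z | F z ≠ G z} ⊆ neighborhood C (deviationSet F)}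

/-- `ψ` is the canonical husking of `F`: the pointwise minimal element of `⋃ₖ Θ_k(F)`. -/
def IsCanonicalHusking {n : ℕ} (F ψ : Lattice n → ℤ) : Prop :=
  IsLeast (⋃ k : ℕ, Theta k F) ψ

end Sandpile

/-! Everything reduces to functions of `t = q ⬝ᵥ z`. A primitive `q` admits `v` with `q ⬝ᵥ v = 1`.
Minimizing a competitor over each level of `q ⬝ᵥ z` keeps it superharmonic, so the husking is `g (q
⬝ᵥ z)`, with `g` the least superharmonic function having the tails of `min 0 t`. An inf-convolution
reduces to profiles (`exists_profile_le`). The least one exists because tails are uniform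
(`exists_uniform_tails`): the flux of a profile is bounded and drops at each nonharmonic point, so
long intervals contain harmonic blocks, where a profile is linear of slope 0 or 1.

By the least action principle, a wave topples each vertex at most once, and its indicator is the
least stabilizing function that is at least 1 at the start (`exists_wave_set`, with converse
`relaxesTo_of_minimal`). The indicator `ψ (z + v) - ψ z` is such a least one because `ψ` is least.
The symmetry `g (-t) + t = g t` gives `-v`.

For uniqueness, let a wave `u` shift a soliton `σ` by `v`. If `q ⬝ᵥ v = 0`, periodicity forces `u`
to be identically 1. Otherwise, up to the sign of `q`, summing `u` along `v` gives a superharmonic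
potential `F` of `σ - (2n - 1)`. A Liouville theorem makes `F` zero on one side and affine in `q ⬝ᵥ
z` on the other; primitivity gives `q ⬝ᵥ v = 1`. A translate of `F` then lies above `ψ`, and
comparison with the functions `ψ (· + j • v)` gives equality (`IsLeastProfile.eq_of_wave`). -/

namespace Sandpile

/-! ### The Laplacian -/

theorem laplacian_eq_sum {n : ℕ} (F : Lattice n → ℤ) (z : Lattice n) :
    laplacian F z = ∑ i, (F (z + Pi.single i 1) + F (z - Pi.single i 1) - 2 * F z) := by
  rw [Finset.sum_sub_distrib, laplacian]
  simp
  ring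

theorem laplacian_add {n : ℕ} (F G : Lattice n → ℤ) (z : Lattice n) :
    laplacian (fun y => F y + G y) z = laplacian F z + laplacian G z := by
  simp only [laplacian_eq_sum, ← Finset.sum_add_distrib]
  exact Finset.sum_congr rfl fun i _ => by ring

theorem laplacian_sub {n : ℕ} (F G : Lattice n → ℤ) (z : Lattice n) :
    laplacian (fun y => F y - G y) z = laplacian F z - laplacian G z := by
  simp only [laplacian_eq_sum, ← Finset.sum_sub_distrib]
  exact Finset.sum_congr rfl fun i _ => by ring

theorem laplacian_const_mul {n : ℕ} (c : ℤ) (F : Lattice n → ℤ) (z : Lattice n) :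
    laplacian (fun y => c * F y) z = c * laplacian F z := by
  simp only [laplacian_eq_sum, Finset.mul_sum]
  exact Finset.sum_congr rfl fun i _ => by ring

theorem laplacian_const {n : ℕ} (c : ℤ) (z : Lattice n) :
    laplacian (fun _ => c) z = 0 := by
  rw [laplacian_eq_sum]
  exact Finset.sum_eq_zero fun i _ => by ring

theorem laplacian_translate {n : ℕ} (F : Lattice n → ℤ) (v z : Lattice n) :
    laplacian (fun y => F (y + v)) z = laplacian F (z + v) := by
  simp only [laplacian_eq_sum]
  refine Finset.sum_congr rfl fun i _ => ?_
  rw [add_right_comm, show z - Pi.single i 1 + v = z + v - Pi.single i 1 by abel]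

theorem laplacian_sum {n : ℕ} {ι : Type*} (s : Finset ι) (F : ι → Lattice n → ℤ) (z : Lattice n) :
    laplacian (fun y => ∑ j ∈ s, F j y) z = ∑ j ∈ s, laplacian (F j) z := by
  classical
  induction s using Finset.induction_on with
  | empty => simpa using laplacian_const 0 z
  | insert a s ha ih => simp only [Finset.sum_insert ha, laplacian_add, ih]

theorem dotProduct_single_one' {n : ℕ} (q : Lattice n) (i : Fin n) :
    q ⬝ᵥ (Pi.single i 1 : Lattice n) = q i := by simp

theorem laplacian_dotProduct {n : ℕ} (q z : Lattice n) :
    laplacian (fun y => q ⬝ᵥ y) z = 0 := by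
  rw [laplacian_eq_sum]
  refine Finset.sum_eq_zero fun i _ => ?_
  rw [dotProduct_add, dotProduct_sub]
  ring

theorem laplacian_congr {n : ℕ} {F G : Lattice n → ℤ} {z : Lattice n} (h0 : F z = G z)
    (h : ∀ i, F (z + Pi.single i 1) = G (z + Pi.single i 1) ∧
      F (z - Pi.single i 1) = G (z - Pi.single i 1)) : laplacian F z = laplacian G z := by
  simp only [laplacian_eq_sum]
  exact Finset.sum_congr rfl fun i _ => by rw [h0, (h i).1, (h i).2]

theorem laplacian_mono {n : ℕ} {F G : Lattice n → ℤ} {z : Lattice n} (h0 : F z = G z)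
    (h : ∀ y, F y ≤ G y) : laplacian F z ≤ laplacian G z := by
  simp only [laplacian_eq_sum]
  exact Finset.sum_le_sum fun i _ => by
    have := h (z + Pi.single i 1)
    have := h (z - Pi.single i 1)
    linarith

/-- If `F` is superharmonic at `z` and its neighbours are at least `F z`, they all equal `F z`. -/
theorem eq_of_laplacian_nonpos {n : ℕ} {F : Lattice n → ℤ} {z : Lattice n}
    (hz : laplacian F z ≤ 0)
    (h : ∀ i, F z ≤ F (z + Pi.single i 1) ∧ F z ≤ F (z - Pi.single i 1)) (i : Fin n) :
    F (z + Pi.single i 1) = F z ∧ F (z - Pi.single i 1) = F z := by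
  rw [laplacian_eq_sum] at hz
  have h0 : ∀ j ∈ Finset.univ,
      0 ≤ F (z + Pi.single j 1) + F (z - Pi.single j 1) - 2 * F z := fun j _ => by
    have := h j
    linarith [this.1, this.2]
  have := (Finset.sum_eq_zero_iff_of_nonneg h0).1 (le_antisymm hz (Finset.sum_nonneg h0)) i
    (Finset.mem_univ i)
  have := h i
  constructor <;> linarith [this.1, this.2]

/-- The difference `G - F` is nonnegative, vanishes at `z` and is superharmonic there. -/
theorem eq_of_contact {n : ℕ} {F G : Lattice n → ℤ} {z : Lattice n} (hle : ∀ y, F y ≤ G y)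
    (h0 : F z = G z) (hlap : laplacian G z ≤ laplacian F z) (i : Fin n) :
    F (z + Pi.single i 1) = G (z + Pi.single i 1) ∧
      F (z - Pi.single i 1) = G (z - Pi.single i 1) := by
  have := eq_of_laplacian_nonpos (F := fun y => G y - F y) (z := z)
    (by rw [laplacian_sub]; linarith)
    (fun j => ⟨by linarith [hle (z + Pi.single j 1)], by linarith [hle (z - Pi.single j 1)]⟩) i
  constructor <;> linarith [this.1, this.2]

/-! ### Half-spaces are connected -/

/-- A property that passes between neighbours in a half-space holds at all its points or at
none. -/
theorem halfspace_connected {n : ℕ} (q : Lattice n) (c : ℤ) (P : Lattice n → Prop)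
    (hP : ∀ z i, q ⬝ᵥ z ≤ c → P z →
      (q ⬝ᵥ (z + Pi.single i 1) ≤ c → P (z + Pi.single i 1)) ∧
      (q ⬝ᵥ (z - Pi.single i 1) ≤ c → P (z - Pi.single i 1)))
    {z y : Lattice n} (hz : q ⬝ᵥ z ≤ c) (hy : q ⬝ᵥ y ≤ c) (h : P z) : P y := by
  have hiff : ∀ z i, q ⬝ᵥ z ≤ c → q ⬝ᵥ (z - Pi.single i 1) ≤ c →
      (P z ↔ P (z - Pi.single i 1)) := fun z i h1 h2 =>
    ⟨fun h => (hP z i h1 h).2 h2, fun h => by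
      simpa using (hP _ i h2 h).1 (by simpa using h1)⟩
  -- Subtracting positive multiples of `s i` from coordinate `i` never raises `q ⬝ᵥ z`. Both points
  -- descend this way to their coordinatewise meet in the order given by the signs `s`.
  set s : Fin n → ℤ := fun i => if 0 ≤ q i then 1 else -1 with hs
  have hss : ∀ i, s i * s i = 1 := fun i => by simp only [hs]; split_ifs <;> norm_num
  have hqs : ∀ i, 0 ≤ q i * s i := fun i => by simp only [hs]; split_ifs <;> linarith
  have step : ∀ i (k : ℕ) z, q ⬝ᵥ z ≤ c →
      q ⬝ᵥ (z - Pi.single i (k * s i)) ≤ c ∧ (P z ↔ P (z - Pi.single i (k * s i))) := by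
    intro i k z hz
    have hmem : ∀ k : ℕ, q ⬝ᵥ (z - Pi.single i (k * s i)) ≤ c := fun k => by
      rw [dotProduct_sub, dotProduct_single]
      nlinarith [hqs i, mul_nonneg (Int.natCast_nonneg k) (hqs i)]
    refine ⟨hmem k, ?_⟩
    induction k with
    | zero => simp
    | succ k ih =>
      rw [ih]
      have h1 := hmem k
      have h2 := hmem (k + 1)
      by_cases hi : 0 ≤ q i
      · have e : z - Pi.single i (((k + 1 : ℕ) : ℤ) * s i) =
            z - Pi.single i ((k : ℤ) * s i) - Pi.single i 1 := by
          simp only [hs, hi, if_true]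
          rw [sub_sub, ← Pi.single_add]; push_cast; ring_nf
        rw [e] at h2 ⊢
        exact hiff _ i h1 h2
      · have e : z - Pi.single i ((k : ℤ) * s i) =
            z - Pi.single i (((k + 1 : ℕ) : ℤ) * s i) - Pi.single i 1 := by
          simp only [hs, hi, if_false]
          rw [sub_sub, ← Pi.single_add]; push_cast; ring_nf
        rw [e] at h1 ⊢
        exact (hiff _ i h2 h1).symm
  have multi : ∀ (w : Fin n → ℕ) (a : Finset (Fin n)) z, q ⬝ᵥ z ≤ c →
      q ⬝ᵥ (z - ∑ i ∈ a, Pi.single i (w i * s i)) ≤ c ∧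
        (P z ↔ P (z - ∑ i ∈ a, Pi.single i (w i * s i))) := by
    intro w a z hz
    induction a using Finset.induction_on with
    | empty => simpa using hz
    | insert i a hi ih =>
      rw [Finset.sum_insert hi, add_comm, ← sub_sub, ih.2]
      exact step i (w i) _ ih.1
  have hz' := (multi (fun i => ((z i - y i) * s i).toNat) Finset.univ z hz).2
  have hy' := (multi (fun i => (-((z i - y i) * s i)).toNat) Finset.univ y hy).2
  rw [hy']
  rw [hz'] at h
  convert h using 1
  rw [Finset.univ_sum_single (fun i => (((-((z i - y i) * s i)).toNat : ℕ) : ℤ) * s i),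
    Finset.univ_sum_single (fun i => ((((z i - y i) * s i).toNat : ℕ) : ℤ) * s i)]
  funext i
  simp only [Pi.sub_apply]
  have h1 := hss i
  have h2 : ((((z i - y i) * s i).toNat : ℕ) : ℤ) - (((-((z i - y i) * s i)).toNat : ℕ) : ℤ)
      = (z i - y i) * s i := by omega
  linear_combination s i * h2 + (z i - y i) * h1

/-- The minimum principle in a half-space. -/
theorem eq_min_of_superharmonic {n : ℕ} {q : Lattice n} {c μ : ℤ} {F : Lattice n → ℤ}
    (hF : ∀ z, q ⬝ᵥ z ≤ c → laplacian F z ≤ 0)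
    (hμ : ∀ z i, q ⬝ᵥ z ≤ c → μ ≤ F (z + Pi.single i 1) ∧ μ ≤ F (z - Pi.single i 1))
    {z₀ : Lattice n} (hz₀ : q ⬝ᵥ z₀ ≤ c) (h₀ : F z₀ = μ) {z : Lattice n} (hz : q ⬝ᵥ z ≤ c) :
    F z = μ := by
  refine halfspace_connected q c (fun z => F z = μ) (fun z i hz h => ?_) hz₀ hz h₀
  have := eq_of_laplacian_nonpos (hF z hz) (fun j => by rw [h]; exact hμ z j hz) i
  rw [h] at this
  exact ⟨fun _ => this.1, fun _ => this.2⟩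

/-- A nonempty set of lattice points on which an integer function is bounded below contains a
minimizer. -/
theorem exists_minimizer {α : Type*} {s : Set α} (hs : s.Nonempty) {F : α → ℤ} {b : ℤ}
    (hb : ∀ z ∈ s, b ≤ F z) : ∃ z ∈ s, ∀ y ∈ s, F z ≤ F y := by
  obtain ⟨z₁, hz₁⟩ := hs
  obtain ⟨z, hz, hmin⟩ := (measure fun z => (F z - b).toNat).wf.has_min s ⟨z₁, hz₁⟩
  refine ⟨z, hz, fun y hy => ?_⟩
  have := hmin y hy
  simp only [InvImage, WellFoundedRelation.rel] at this
  have := hb z hz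
  have := hb y hy
  simp at *
  omega

/-- An integer-valued superharmonic function on `ℤⁿ` that is bounded below is constant. -/
theorem superharmonic_const {n : ℕ} {F : Lattice n → ℤ} {b : ℤ}
    (hF : ∀ z, laplacian F z ≤ 0) (hb : ∀ z, b ≤ F z) (z y : Lattice n) : F z = F y := by
  obtain ⟨z₀, -, h⟩ := exists_minimizer (Set.univ_nonempty (α := Lattice n)) fun z _ => hb z
  have key : ∀ z, F z = F z₀ := fun z =>
    -- For `q = 0` and `c = 0` the half-space is the whole lattice.
    eq_min_of_superharmonic (q := 0) (c := 0) (fun z _ => hF z)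
      (fun z i _ => ⟨h _ trivial, h _ trivial⟩) (by simp) rfl (by simp)
  rw [key z, key y]

/-! ### Topplings -/

theorem adj_iff {n : ℕ} (x z : Lattice n) :
    Adj x z ↔ ∃ i, z = x + Pi.single i 1 ∨ z = x - Pi.single i 1 := by
  constructor
  · intro h
    unfold Adj at h
    have hne : ∃ i, x i - z i ≠ 0 := by
      by_contra! h0
      simp [h0] at h
    obtain ⟨i, hi⟩ := hne
    have hsum := Finset.add_sum_erase Finset.univ (fun j => (x j - z j) ^ 2) (Finset.mem_univ i)
    have hpos : 0 < (x i - z i) ^ 2 := by positivity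
    have hnn : ∀ j ∈ Finset.univ.erase i, 0 ≤ (x j - z j) ^ 2 := fun j _ => sq_nonneg _
    have h0 := Finset.sum_nonneg hnn
    have hz : ∀ j, j ≠ i → x j - z j = 0 := fun j hj => by
      have := (Finset.sum_eq_zero_iff_of_nonneg hnn).1 (by linarith) j (by simp [hj])
      exact pow_eq_zero_iff two_ne_zero |>.1 this
    have h1 : (x i - z i) ^ 2 = 1 := by linarith
    refine ⟨i, ?_⟩
    rcases mul_self_eq_one_iff.1 ((sq _).symm.trans h1) with h1 | h1
    · right
      funext j
      by_cases hj : j = i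
      · subst hj; simp; linarith
      · simp [hj]; linarith [hz j hj]
    · left
      funext j
      by_cases hj : j = i
      · subst hj; simp; linarith
      · simp [hj]; linarith [hz j hj]
  · rintro ⟨i, rfl | rfl⟩ <;> simp [Adj, Pi.single_apply]

open Classical in
theorem topple_eq {n : ℕ} (σ : Lattice n → ℤ) (x z : Lattice n) :
    topple σ x z = σ z + laplacian (fun y => if y = x then 1 else 0) z := by
  have hne : ∀ i j : Fin n, (Pi.single i 1 : Lattice n) + Pi.single j 1 ≠ 0 := fun i j h => by
    have := congrFun h i
    by_cases hij : i = j
    · subst hij; simp at this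
    · simp [hij] at this
  have hinj : ∀ i j : Fin n, (Pi.single i 1 : Lattice n) = Pi.single j 1 ↔ j = i := fun i j => by
    constructor
    · intro h
      by_contra hij
      have := congrFun h i
      simp [Ne.symm hij] at this
    · rintro rfl; rfl
  have key : ∑ i, ((if z + Pi.single i 1 = x then (1 : ℤ) else 0) +
      (if z - Pi.single i 1 = x then 1 else 0)) = if Adj x z then 1 else 0 := by
    by_cases h : Adj x z
    · rw [if_pos h]
      obtain ⟨i, rfl | rfl⟩ := (adj_iff x z).1 h
      · have h1 : ∀ j, ¬ x + Pi.single i 1 + Pi.single j 1 = x := fun j h => hne i j (by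
          rw [add_assoc] at h; simpa using h)
        have h2 : ∀ j, x + Pi.single i 1 - Pi.single j 1 = x ↔ j = i := fun j => by
          rw [add_sub_assoc, add_eq_left, sub_eq_zero, hinj]
        simp [h1, h2]
      · have h1 : ∀ j, ¬ x - Pi.single i 1 - Pi.single j 1 = x := fun j h => hne i j (by
          rw [sub_sub] at h; simpa using h)
        have h2 : ∀ j, x - Pi.single i 1 + Pi.single j 1 = x ↔ j = i := fun j => by
          rw [sub_add, sub_eq_self, sub_eq_zero, hinj]
        simp [h1, h2]
    · rw [if_neg h]
      refine Finset.sum_eq_zero fun i _ => ?_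
      rw [adj_iff] at h
      push Not at h
      rw [if_neg fun h' => (h i).2 (by rw [← h']; abel),
        if_neg fun h' => (h i).1 (by rw [← h']; abel), add_zero]
  rw [topple, laplacian, key]
  split_ifs <;> ring

/-! ### Functions of one integer variable -/

/-- The Laplacian of `z ↦ g (q ⬝ᵥ z)` as an operator on functions of one integer variable. -/
def lineLaplacian {n : ℕ} (q : Lattice n) (g : ℤ → ℤ) (t : ℤ) : ℤ :=
  ∑ i, (g (t + q i) + g (t - q i) - 2 * g t)

theorem laplacian_comp_dotProduct {n : ℕ} (q : Lattice n) (g : ℤ → ℤ) (z : Lattice n) :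
    laplacian (fun y => g (q ⬝ᵥ y)) z = lineLaplacian q g (q ⬝ᵥ z) := by
  simp only [laplacian_eq_sum, lineLaplacian, dotProduct_add, dotProduct_sub,
    dotProduct_single_one']

theorem lineLaplacian_translate {n : ℕ} (q : Lattice n) (g : ℤ → ℤ) (a c t : ℤ) :
    lineLaplacian q (fun s => g (s + a) + c) t = lineLaplacian q g (t + a) := by
  refine Finset.sum_congr rfl fun i _ => ?_
  simp only
  rw [add_right_comm t, show t - q i + a = t + a - q i by ring]
  ring

/-- The reflection `g (-s) + s` fixes `min 0 s` and exchanges the slopes 0 and 1, so results on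
right tails transfer to left tails. -/
theorem lineLaplacian_reflect {n : ℕ} (q : Lattice n) (g : ℤ → ℤ) (t : ℤ) :
    lineLaplacian q (fun s => g (-s) + s) t = lineLaplacian q g (-t) := by
  refine Finset.sum_congr rfl fun i _ => ?_
  simp only
  rw [show -(t + q i) = -t - q i by ring, show -(t - q i) = -t + q i by ring]
  ring

theorem lineLaplacian_neg {n : ℕ} (q : Lattice n) (g : ℤ → ℤ) (t : ℤ) :
    lineLaplacian (-q) g t = lineLaplacian q g t := by
  refine Finset.sum_congr rfl fun i _ => ?_
  rw [Pi.neg_apply, sub_neg_eq_add, ← sub_eq_add_neg]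
  ring

theorem lineLaplacian_nonpos_of_isLeast {n : ℕ} {q : Lattice n} {ι : Type*} {h : ι → ℤ → ℤ}
    {g : ℤ → ℤ} (hg : ∀ t, IsLeast (Set.range fun j => h j t) (g t))
    (hh : ∀ j t, lineLaplacian q (h j) t ≤ 0) (t : ℤ) : lineLaplacian q g t ≤ 0 := by
  obtain ⟨j, hj⟩ := (hg t).1
  refine le_trans (Finset.sum_le_sum fun i _ => ?_) (hh j t)
  have h1 := (hg (t + q i)).2 ⟨j, rfl⟩
  have h2 := (hg (t - q i)).2 ⟨j, rfl⟩
  simp only at hj h1 h2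
  linarith

/-- A *profile* is a function all of whose increments are `0` or `1`. -/
def IsProfile (g : ℤ → ℤ) : Prop := Monotone g ∧ Antitone fun t => g t - t

theorem IsProfile.reflect {g : ℤ → ℤ} (hg : IsProfile g) : IsProfile fun t => g (-t) + t := by
  refine ⟨fun s t h => ?_, fun s t h => ?_⟩
  · have := hg.2 (neg_le_neg h)
    simp only at this ⊢
    linarith
  · have := hg.1 (neg_le_neg h)
    simp only
    linarith

theorem IsProfile.succ {g : ℤ → ℤ} (hg : IsProfile g) (t : ℤ) :
    g (t + 1) = g t ∨ g (t + 1) = g t + 1 := by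
  have h1 := hg.1 (show t ≤ t + 1 by linarith)
  have h2 := hg.2 (show t ≤ t + 1 by linarith)
  simp only at h2
  omega

theorem isLeast_exists {s : Set ℤ} (hs : s.Nonempty) {b : ℤ} (hb : ∀ x ∈ s, b ≤ x) :
    ∃ m, IsLeast s m :=
  ⟨sInf s, Int.csInf_mem hs ⟨b, hb⟩, fun _ hx => csInf_le ⟨b, hb⟩ hx⟩

/-- Just before a first increase beyond `a + M`, all values at `t ± q i` are at least `g a` and one
is larger, so the Laplacian would be positive. The length `M` keeps these points to the right of
`a`. -/
theorem const_of_flat {n : ℕ} {q : Lattice n} {M : ℤ} (hM : ∀ i, |q i| ≤ M)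
    (hq : ∃ i, q i ≠ 0) {g : ℤ → ℤ} (hg : Monotone g) (hsup : ∀ t, lineLaplacian q g t ≤ 0)
    {a : ℤ} (hflat : g (a + M) = g a) {t : ℤ} (ht : a ≤ t) : g t = g a := by
  obtain ⟨i₀, hi₀⟩ := hq
  have hM0 : 0 ≤ M := (abs_nonneg _).trans (hM i₀)
  have key : ∀ k : ℕ, g (a + M + k) = g a := by
    intro k
    induction k with
    | zero => simpa using hflat
    | succ k ih =>
      by_contra hne
      have hgt : g a < g (a + M + k + 1) := by
        have h := hg (show a ≤ a + M + k + 1 by linarith [Int.natCast_nonneg k])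
        push_cast at hne
        rw [← add_assoc] at hne
        exact lt_of_le_of_ne h (Ne.symm hne)
      have hge : ∀ s, a ≤ s → g a ≤ g s := fun s hs => hg hs
      have hb : ∀ i, a ≤ a + M + k + q i ∧ a ≤ a + M + k - q i := fun i => by
        have := abs_le.1 (hM i)
        constructor <;> linarith [Int.natCast_nonneg k, this.1, this.2]
      have : 0 < lineLaplacian q g (a + M + k) := by
        refine Finset.sum_pos' (fun i _ => ?_) ⟨i₀, Finset.mem_univ _, ?_⟩
        · linarith [hge _ (hb i).1, hge _ (hb i).2]
        · rcases lt_or_gt_of_ne hi₀ with h | h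
          · have := hg (show a + M + k + 1 ≤ a + M + k - q i₀ by omega)
            linarith [hge _ (hb i₀).1]
          · have := hg (show a + M + k + 1 ≤ a + M + k + q i₀ by omega)
            linarith [hge _ (hb i₀).2]
      linarith [hsup (a + M + k)]
  refine le_antisymm ?_ (hg ht)
  have := key (t - a).toNat
  rw [← this]
  exact hg (by omega)

/-! ### The flux of a profile -/

/-- The flux of `g` through `t`; its increments are the values of the Laplacian. -/
def flux {n : ℕ} (q : Lattice n) (g : ℤ → ℤ) (t : ℤ) : ℤ :=
  ∑ i, ∑ s ∈ Finset.range (q i).natAbs, (g (t - 1 - s + |q i|) - g (t - 1 - s))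

/-- A discrete Gauss theorem: the flux sums the differences of `g` over all steps of length `|q i|`
from a point below `t` to one not below `t`. -/
theorem flux_succ {n : ℕ} (q : Lattice n) (g : ℤ → ℤ) (t : ℤ) :
    flux q g (t + 1) = flux q g t + lineLaplacian q g t := by
  rw [flux, flux, lineLaplacian, ← sub_eq_iff_eq_add', ← Finset.sum_sub_distrib]
  refine Finset.sum_congr rfl fun i _ => ?_
  rw [← Finset.sum_sub_distrib]
  have := Finset.sum_range_sub' (fun s : ℕ => g (t - s + |q i|) - g (t - s)) (q i).natAbs
  have h2 : ((q i).natAbs : ℤ) = |q i| := Int.natCast_natAbs _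
  rw [h2] at this
  convert this using 1
  · refine Finset.sum_congr rfl fun s _ => ?_
    push_cast
    ring_nf
  · simp only [Nat.cast_zero, sub_zero, sub_add_cancel]
    rcases abs_choice (q i) with h | h <;> rw [h]
    · ring
    · rw [← sub_eq_add_neg, sub_neg_eq_add]; ring

theorem flux_nonneg {n : ℕ} (q : Lattice n) {g : ℤ → ℤ} (hg : Monotone g) (t : ℤ) :
    0 ≤ flux q g t :=
  Finset.sum_nonneg fun i _ => Finset.sum_nonneg fun s _ =>
    sub_nonneg.2 (hg (by linarith [abs_nonneg (q i)]))

theorem flux_le {n : ℕ} (q : Lattice n) {g : ℤ → ℤ} (hg : IsProfile g) (t : ℤ) :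
    flux q g t ≤ ∑ i, |q i| * |q i| := by
  refine Finset.sum_le_sum fun i _ => ?_
  refine (Finset.sum_le_card_nsmul _ _ |q i| fun s _ => ?_).trans ?_
  · have := hg.2 (show t - 1 - (s : ℤ) ≤ t - 1 - s + |q i| by linarith [abs_nonneg (q i)])
    simp only at this
    linarith
  · simp

/-- The flux decreases and stays between 0 and `N`. A nonharmonic point in each of `N + 1`
consecutive blocks of length `R` would make it negative. -/
theorem exists_harmonic_block {n : ℕ} (q : Lattice n) {g : ℤ → ℤ} (hg : IsProfile g)
    (hsup : ∀ t, lineLaplacian q g t ≤ 0) {N : ℕ} (hN : ∑ i, |q i| * |q i| ≤ N) (R : ℕ) (a : ℤ) :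
    ∃ b, a ≤ b ∧ b + R ≤ a + (N + 1) * R ∧ ∀ t, b ≤ t → t < b + R → lineLaplacian q g t = 0 := by
  have hanti : Antitone (flux q g) :=
    antitone_int_of_succ_le fun t => by rw [flux_succ]; linarith [hsup t]
  by_contra! hcon
  have key : ∀ l : ℕ, l ≤ N + 1 → flux q g (a + l * R) ≤ flux q g a - l := by
    intro l
    induction l with
    | zero => simp
    | succ l ih =>
      intro hl
      have hl' : (l : ℤ) ≤ N := by exact_mod_cast Nat.le_of_succ_le_succ hl
      have h0 : (0 : ℤ) ≤ R := Int.natCast_nonneg R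
      obtain ⟨t, h1, h2, h3⟩ := hcon (a + l * R)
        (by linarith [mul_nonneg (Int.natCast_nonneg l) h0])
        (by nlinarith)
      have h4 := hanti h1
      have h5 := hanti (show t + 1 ≤ a + ((l + 1 : ℕ) : ℤ) * R by push_cast; linarith)
      rw [flux_succ] at h5
      have h6 := lt_of_le_of_ne (hsup t) h3
      have := ih (by omega)
      push_cast at h5 ⊢
      linarith
  have := key (N + 1) le_rfl
  have := flux_nonneg q hg.1 (a + ((N + 1 : ℕ) : ℤ) * R)
  have := flux_le q hg a
  push_cast at *
  linarith

/-! ### Harmonic profiles -/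

/-- The increments are harmonic with values 0 and 1, so each is extremal and equals those at
distance `q i`. The `q i` generate `ℤ`; the margin `ρ` absorbs the excursions made when their shifts
are composed. -/
theorem increment_const_of_harmonic {n : ℕ} {q v : Lattice n} (hv : q ⬝ᵥ v = 1) :
    ∃ ρ : ℕ, ∀ g, IsProfile g → ∀ a b, (∀ t, a ≤ t → t ≤ b → lineLaplacian q g t = 0) →
      ∀ t, a + ρ ≤ t → t + ρ ≤ b → g (t + 1 + 1) - g (t + 1) = g (t + 1) - g t := by
  let H : AddSubgroup ℤ :=
    { carrier := {τ | ∃ ρ : ℕ, ∀ g, IsProfile g →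
        ∀ a b, (∀ t, a ≤ t → t ≤ b → lineLaplacian q g t = 0) →
        ∀ t, a + ρ ≤ t → t + ρ ≤ b → g (t + τ + 1) - g (t + τ) = g (t + 1) - g t}
      zero_mem' := ⟨0, fun g _ a b _ t _ _ => by simp⟩
      add_mem' := by
        rintro τ₁ τ₂ ⟨ρ₁, h₁⟩ ⟨ρ₂, h₂⟩
        refine ⟨ρ₁ + ρ₂ + τ₁.natAbs, fun g hg a b hab t h3 h4 => ?_⟩
        rw [← h₁ g hg a b hab t (by omega) (by omega), ← add_assoc,
          h₂ g hg a b hab (t + τ₁) (by omega) (by omega)]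
      neg_mem' := by
        rintro τ ⟨ρ, h⟩
        refine ⟨ρ + τ.natAbs, fun g hg a b hab t h3 h4 => ?_⟩
        rw [← h g hg a b hab (t + -τ) (by omega) (by omega), neg_add_cancel_right] }
  have hmem : ∀ i, q i ∈ H := fun i => by
    refine ⟨1, fun g hg a b hab t h3 h4 => ?_⟩
    have h1 := hab t (by push_cast at h3; linarith) (by push_cast at h4; linarith)
    have h2 := hab (t + 1) (by push_cast at h3; linarith) (by push_cast at h4; linarith)
    set d : ℤ → ℤ := fun s => g (s + 1) - g s with hd
    have hd01 : ∀ s, d s = 0 ∨ d s = 1 := fun s => by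
      rcases hg.succ s with h | h <;> simp only [hd, h] <;> simp
    have hsum : ∑ j, (d (t + q j) + d (t - q j) - 2 * d t) = 0 := by
      rw [← sub_self (0 : ℤ)]
      nth_rewrite 1 [← h2]
      rw [← h1, lineLaplacian, lineLaplacian, ← Finset.sum_sub_distrib]
      refine Finset.sum_congr rfl fun j _ => ?_
      simp only [hd]
      rw [add_right_comm t (q j), show t - q j + 1 = t + 1 - q j by ring]
      ring
    rcases hd01 t with h0 | h0
    · have hn : ∀ j ∈ Finset.univ, 0 ≤ d (t + q j) + d (t - q j) - 2 * d t := fun j _ => by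
        rcases hd01 (t + q j) with h | h <;> rcases hd01 (t - q j) with h' | h' <;>
          rw [h, h', h0] <;> norm_num
      have := (Finset.sum_eq_zero_iff_of_nonneg hn).1 hsum i (Finset.mem_univ i)
      change d (t + q i) = d t
      rcases hd01 (t + q i) with h | h <;> rcases hd01 (t - q i) with h' | h' <;>
        rw [h, h', h0] at this <;> simp_all
    · have hn : ∀ j ∈ Finset.univ, d (t + q j) + d (t - q j) - 2 * d t ≤ 0 := fun j _ => by
        rcases hd01 (t + q j) with h | h <;> rcases hd01 (t - q j) with h' | h' <;>
          rw [h, h', h0] <;> norm_num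
      have := (Finset.sum_eq_zero_iff_of_nonpos hn).1 hsum i (Finset.mem_univ i)
      change d (t + q i) = d t
      rcases hd01 (t + q i) with h | h <;> rcases hd01 (t - q i) with h' | h' <;>
        rw [h, h', h0] at this <;> simp_all
  have h1 : (1 : ℤ) ∈ H := by
    rw [← hv, dotProduct]
    refine sum_mem fun i _ => ?_
    rw [mul_comm, ← smul_eq_mul]
    exact H.zsmul_mem (hmem i) _
  exact h1

/-! ### Tails of superharmonic profiles -/

/-- `g` coincides with `t ↦ min 0 t` outside a finite set. -/
def HasTails (g : ℤ → ℤ) : Prop := ∃ C : ℕ, ∀ t : ℤ, ↑C ≤ t ∨ t ≤ -C → g t = min 0 t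

theorem HasTails.reflect {g : ℤ → ℤ} (hg : HasTails g) : HasTails fun t => g (-t) + t := by
  obtain ⟨C, hC⟩ := hg
  refine ⟨C, fun t ht => ?_⟩
  simp only
  rw [hC (-t) (by omega)]
  omega

theorem HasTails.right {g : ℤ → ℤ} (hg : HasTails g) : ∃ C, ∀ t, C ≤ t → g t = 0 := by
  obtain ⟨C, hC⟩ := hg
  exact ⟨C, fun t ht => by rw [hC t (by omega)]; omega⟩

theorem IsProfile.nonpos {g : ℤ → ℤ} (hg : IsProfile g) (ht : HasTails g) (t : ℤ) : g t ≤ 0 := by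
  obtain ⟨C, hC⟩ := ht.right
  rw [← hC (max C t) (le_max_left _ _)]
  exact hg.1 (le_max_right _ _)

theorem IsProfile.le_min {g : ℤ → ℤ} (hg : IsProfile g) (ht : HasTails g) (t : ℤ) :
    g t ≤ min 0 t := by
  have := hg.reflect.nonpos ht.reflect (-t)
  simp only [neg_neg] at this
  exact _root_.le_min (hg.nonpos ht t) (by linarith)

/-- The superharmonic profiles with tails coincide with `t ↦ min 0 t` outside one interval. -/
theorem exists_uniform_tails {n : ℕ} {q v : Lattice n} (hv : q ⬝ᵥ v = 1) :
    ∃ B : ℕ, ∀ g, IsProfile g → (∀ t, lineLaplacian q g t ≤ 0) → HasTails g →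
      ∀ t : ℤ, ↑B ≤ t ∨ t ≤ -B → g t = min 0 t := by
  obtain ⟨ρ, hρ⟩ := increment_const_of_harmonic hv
  have hq : ∃ i, q i ≠ 0 := by
    by_contra! h
    simp [dotProduct, h] at hv
  set M : ℕ := ∑ i, (q i).natAbs with hMdef
  have hM : ∀ i, |q i| ≤ (M : ℤ) := fun i => by
    rw [Int.abs_eq_natAbs]
    exact_mod_cast Finset.single_le_sum (f := fun i => (q i).natAbs) (fun _ _ => Nat.zero_le _)
      (Finset.mem_univ i)
  have hMpos : 0 < (M : ℤ) := by
    obtain ⟨i, hi⟩ := hq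
    exact (abs_pos.2 hi).trans_le (hM i)
  obtain ⟨N, hN⟩ := Int.eq_ofNat_of_zero_le (a := ∑ i, |q i| * |q i|)
    (Finset.sum_nonneg fun i _ => mul_nonneg (abs_nonneg _) (abs_nonneg _))
  -- After a margin `ρ` at each end, room remains for the stretch of length `M` that `const_of_flat`
  -- requires.
  set R : ℕ := M + 2 * ρ + 2 with hR
  have right : ∀ g, IsProfile g → (∀ t, lineLaplacian q g t ≤ 0) → HasTails g →
      ∀ t, ((N : ℤ) + 1) * R ≤ t → g t = 0 := by
    intro g hg hsup ht
    obtain ⟨b, hb0, hb1, hb⟩ := exists_harmonic_block q hg hsup hN.le R 0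
    set a := b + ρ with ha
    have hconst : ∀ k : ℕ, k ≤ M → g (a + k + 1) - g (a + k) = g (a + 1) - g a := by
      intro k
      induction k with
      | zero => simp
      | succ k ih =>
        intro hk
        rw [← ih (by omega), ← hρ g hg b (b + R - 1) (fun t h1 h2 => hb t h1 (by linarith))
          (a + k) (by omega) (by omega)]
        push_cast
        ring_nf
    have hlin : ∀ k : ℕ, k ≤ M → g (a + k) = g a + k * (g (a + 1) - g a) := by
      intro k
      induction k with
      | zero => simp
      | succ k ih =>
        intro hk
        have h1 := ih (by omega)
        have h2 := hconst k (by omega)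
        push_cast
        rw [← add_assoc]
        linarith
    have hlinM := hlin M le_rfl
    rcases hg.succ a with h0 | h0
    · rw [h0, sub_self, mul_zero, add_zero] at hlinM
      have hflat : ∀ t, a ≤ t → g t = g a := fun t h => const_of_flat hM hq hg.1 hsup hlinM h
      obtain ⟨C, hC⟩ := ht.right
      intro t h
      rw [hflat t (by omega), ← hflat (max a C) (le_max_left _ _), hC _ (le_max_right _ _)]
    -- Slope 1 is flatness of the reflected profile. The left tail then gives `g (a + M) = a + M >
    -- 0`, although profiles with tails are nonpositive.
    · exfalso
      rw [h0, add_sub_cancel_left, mul_one] at hlinM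
      have hflat : ∀ t, -(a + M) ≤ t → g (-t) + t = g (- -(a + M)) + -(a + M) := fun t h =>
        const_of_flat (g := fun t => g (-t) + t) hM hq hg.reflect.1
          (fun t => by rw [lineLaplacian_reflect]; exact hsup _)
          (by
            rw [show -(-(a + (M : ℤ)) + M) = a by ring, neg_neg, hlinM]
            ring) h
      obtain ⟨C, hC⟩ := ht.reflect.right
      have h1 := hflat (max (-(a + M)) C) (le_max_left _ _)
      have h2 := hC (max (-(a + M)) C) (le_max_right _ _)
      have h3 := hg.nonpos ht (a + M)
      rw [h2, neg_neg] at h1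
      omega
  refine ⟨(N + 1) * R, fun g hg hsup ht t h => ?_⟩
  have h0 : (0 : ℤ) ≤ ((N + 1) * R : ℕ) := Int.natCast_nonneg _
  rcases h with h | h
  · rw [right g hg hsup ht t (by push_cast at h; exact h)]
    omega
  · have := right _ hg.reflect (fun t => by rw [lineLaplacian_reflect]; exact hsup _)
      ht.reflect (-t) (by push_cast at h; linarith)
    simp only [neg_neg] at this
    omega

/-! ### The least superharmonic profile -/

/-- Below every superharmonic function with tails there is a superharmonic profile with tails. -/
theorem exists_profile_le {n : ℕ} {q : Lattice n} {g : ℤ → ℤ}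
    (hsup : ∀ t, lineLaplacian q g t ≤ 0) {k : ℤ} (hk : ∀ t, min 0 t - k ≤ g t)
    (ht : HasTails g) :
    ∃ h, IsProfile h ∧ (∀ t, lineLaplacian q h t ≤ 0) ∧ HasTails h ∧ ∀ t, h t ≤ g t := by
  have hlow : ∀ t j, min 0 t - k ≤ g (t + j) + max 0 (-j) := fun t j => by
    have := hk (t + j)
    omega
  -- The inf-convolution of `g` with `max 0`: it inherits slopes in `[0, 1]` from `max 0`, and
  -- superharmonicity from being a minimum of translates of `g` plus constants.
  choose h hh using fun t : ℤ =>
    isLeast_exists (s := Set.range fun j : ℤ => g (t + j) + max 0 (-j)) (Set.range_nonempty _)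
      (b := min 0 t - k) (by rintro _ ⟨j, rfl⟩; exact hlow t j)
  have hle : ∀ t j, h t ≤ g (t + j) + max 0 (-j) := fun t j => (hh t).2 ⟨j, rfl⟩
  have hex : ∀ t, ∃ j, g (t + j) + max 0 (-j) = h t := fun t => (hh t).1
  have hhg : ∀ t, h t ≤ g t := fun t => by simpa using hle t 0
  refine ⟨h, ⟨monotone_int_of_le_succ fun t => ?_, antitone_int_of_succ_le fun t => ?_⟩,
    lineLaplacian_nonpos_of_isLeast hh fun j t => ?_, ?_, hhg⟩
  · obtain ⟨j, hj⟩ := hex (t + 1)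
    have := hle t (j + 1)
    rw [show t + (j + 1) = t + 1 + j by ring] at this
    omega
  · obtain ⟨j, hj⟩ := hex t
    have := hle (t + 1) (j - 1)
    rw [show t + 1 + (j - 1) = t + j by ring] at this
    omega
  · rw [lineLaplacian_translate]
    exact hsup _
  · obtain ⟨C, hC⟩ := ht
    refine ⟨C + k.natAbs + 1, fun t h0 => le_antisymm ?_ ?_⟩
    · rw [← hC t (by omega)]
      exact hhg t
    · obtain ⟨j, hj⟩ := hex t
      rw [← hj]
      have h1 := hk (t + j)
      by_cases h2 : ↑C ≤ t + j ∨ t + j ≤ -C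
      · rw [hC _ h2]
        omega
      · omega

theorem lineLaplacian_min_nonpos {n : ℕ} (q : Lattice n) (t : ℤ) :
    lineLaplacian q (fun s => min 0 s) t ≤ 0 :=
  Finset.sum_nonpos fun i _ => by simp only; omega

/-- `g` is the least superharmonic function with tails, and its increments are `0` or `1`. -/
structure IsLeastProfile {n : ℕ} (q : Lattice n) (g : ℤ → ℤ) : Prop where
  profile : IsProfile g
  superharmonic : ∀ t, lineLaplacian q g t ≤ 0
  tails : HasTails g
  le_of : ∀ h k, (∀ t, lineLaplacian q h t ≤ 0) → (∀ t, min 0 t - k ≤ h t) → HasTails h →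
    ∀ t, g t ≤ h t

/-- The least superharmonic function with tails. -/
theorem exists_least_profile {n : ℕ} {q v : Lattice n} (hv : q ⬝ᵥ v = 1) :
    ∃ g, IsLeastProfile q g := by
  obtain ⟨B, hB⟩ := exists_uniform_tails hv
  let ι := {h : ℤ → ℤ // IsProfile h ∧ (∀ t, lineLaplacian q h t ≤ 0) ∧ HasTails h}
  have : Nonempty ι := ⟨⟨fun s => min 0 s, ⟨fun s t h => by simp only; omega,
    fun s t h => by simp only; omega⟩, lineLaplacian_min_nonpos q, 0, fun t _ => rfl⟩⟩
  -- The uniform `B` bounds all candidates below at each point, so their pointwise minimum exists.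
  have hlow : ∀ (h : ι) t, min t (-(B : ℤ)) ≤ h.1 t := by
    rintro ⟨h, h1, h2, h3⟩ t
    by_cases ht : ↑B ≤ t ∨ t ≤ -B
    · simp only
      rw [hB h h1 h2 h3 t ht]
      omega
    · have := h1.1 (show -(B : ℤ) ≤ t by omega)
      rw [hB h h1 h2 h3 (-B) (by omega)] at this
      simp only
      omega
  choose g hg using fun t : ℤ =>
    isLeast_exists (s := Set.range fun h : ι => h.1 t) (Set.range_nonempty _)
      (b := min t (-(B : ℤ))) (by rintro _ ⟨h, rfl⟩; exact hlow h t)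
  have hle : ∀ (h : ι) t, g t ≤ h.1 t := fun h t => (hg t).2 ⟨h, rfl⟩
  refine ⟨g, ⟨fun s t h => ?_, fun s t h => ?_⟩,
    lineLaplacian_nonpos_of_isLeast hg fun h => h.2.2.1, ⟨B, fun t h => ?_⟩,
    fun h k h1 h2 h3 t => ?_⟩
  · obtain ⟨j, hj⟩ := (hg t).1
    have h1 := hle j s
    have h2 := j.2.1.1 h
    simp only at hj
    linarith
  · obtain ⟨j, hj⟩ := (hg s).1
    have h1 := hle j t
    have h2 := j.2.1.2 h
    simp only at hj h2 ⊢
    linarith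
  · obtain ⟨j, hj⟩ := (hg t).1
    rw [← hj]
    exact hB j.1 j.2.1 j.2.2.1 j.2.2.2 t h
  · obtain ⟨h', h4, h5, h6, h7⟩ := exists_profile_le h1 h2 h3
    exact (hle ⟨h', h4, h5, h6⟩ t).trans (h7 t)

theorem HasTails.exists_min_sub_le {g : ℤ → ℤ} (ht : HasTails g) (hg : IsProfile g) :
    ∃ k : ℤ, ∀ t, min 0 t - k ≤ g t := by
  obtain ⟨K, hK⟩ := ht
  refine ⟨K, fun t => ?_⟩
  by_cases h : ↑K ≤ t ∨ t ≤ -K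
  · rw [hK _ h]; omega
  · have h1 := hg.1 (show -(K : ℤ) ≤ t by omega)
    rw [hK (-K) (by omega)] at h1
    omega

theorem IsLeastProfile.neg {n : ℕ} {q : Lattice n} {g : ℤ → ℤ} (hg : IsLeastProfile q g) :
    IsLeastProfile (-q) g where
  profile := hg.profile
  superharmonic t := by rw [lineLaplacian_neg]; exact hg.superharmonic t
  tails := hg.tails
  le_of h k h1 := hg.le_of h k fun t => by rw [← lineLaplacian_neg]; exact h1 t

/-- The reflection is a competitor, so `g` lies below it at `t` and at `-t`; together these are an
equality. -/
theorem IsLeastProfile.reflect_eq {n : ℕ} {q : Lattice n} {g : ℤ → ℤ} (hg : IsLeastProfile q g) :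
    (fun t => g (-t) + t) = g := by
  obtain ⟨k, hk⟩ := hg.tails.exists_min_sub_le hg.profile
  have key := hg.le_of (fun t => g (-t) + t) k
    (fun t => by rw [lineLaplacian_reflect]; exact hg.superharmonic _)
    (fun t => by have := hk (-t); omega) hg.tails.reflect
  funext t
  have h1 := key t
  have h2 := key (-t)
  simp only [neg_neg] at h1 h2 ⊢
  linarith

theorem IsLeastProfile.lineLaplacian_symm {n : ℕ} {q : Lattice n} {g : ℤ → ℤ}
    (hg : IsLeastProfile q g) (t : ℤ) : lineLaplacian q g (-t) = lineLaplacian q g t := by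
  rw [← lineLaplacian_reflect, hg.reflect_eq]

/-! ### Strips and huskings -/

theorem IsPrimitive.exists_dotProduct_eq_one {n : ℕ} {q : Lattice n} (hq : IsPrimitive q) :
    ∃ v : Lattice n, q ⬝ᵥ v = 1 := by
  let I : Ideal ℤ := LinearMap.range (dotProductBilin ℤ ℤ q : Lattice n →ₗ[ℤ] ℤ)
  obtain ⟨d, hd⟩ := (IsPrincipalIdealRing.principal I).principal
  have hdvd : ∀ i, d ∣ q i := fun i => by
    have : q i ∈ I := ⟨Pi.single i 1, by simp⟩
    rw [hd] at this
    exact Ideal.mem_span_singleton.1 this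
  choose q' hq' using hdvd
  have hd1 : d.natAbs = 1 := by
    by_contra hne
    apply hq
    rcases Nat.lt_or_gt_of_ne hne with h | h
    -- The vector `q = 0` is not primitive, since it equals `2 • 0`.
    · have h0 : d = 0 := by omega
      refine ⟨2, 0, by norm_num, ?_⟩
      funext i
      simp [hq' i, h0]
    · refine ⟨d.natAbs, d.sign • q', by exact_mod_cast h, ?_⟩
      rw [smul_smul, mul_comm, Int.sign_mul_natAbs]
      funext i
      simp [hq' i]
  have h1 : (1 : ℤ) ∈ I := by
    rw [hd]
    exact Ideal.mem_span_singleton.2 (Int.isUnit_iff_natAbs_eq.2 hd1).dvd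
  obtain ⟨v, hv⟩ := h1
  exact ⟨v, by simpa using hv⟩

theorem abs_le_sum_abs {n : ℕ} (q : Lattice n) (i : Fin n) : |q i| ≤ ∑ j, |q j| :=
  Finset.single_le_sum (f := fun j => |q j|) (fun _ _ => abs_nonneg _) (Finset.mem_univ i)

theorem lineLaplacian_min_eq_zero {n : ℕ} (q : Lattice n) {t : ℤ}
    (ht : ∑ j, |q j| ≤ t ∨ t ≤ -∑ j, |q j|) : lineLaplacian q (fun s => min 0 s) t = 0 := by
  refine Finset.sum_eq_zero fun i _ => ?_
  have h := abs_le.1 (abs_le_sum_abs q i)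
  simp only
  omega

/-- The deviation set lies in a strip, and `q ⬝ᵥ z` changes boundedly over bounded distances. The
crude inequality `|x| ≤ x ^ 2` for integers avoids square roots. -/
theorem exists_strip {n : ℕ} {q : Lattice n} {C : ℝ} {s : Set (Lattice n)}
    (hs : s ⊆ neighborhood C (deviationSet fun z => min 0 (q ⬝ᵥ z))) :
    ∃ K : ℕ, ∀ z, ↑K ≤ q ⬝ᵥ z ∨ q ⬝ᵥ z ≤ -K → z ∉ s := by
  set M := ∑ j, |q j| with hM
  have hM0 : 0 ≤ M := Finset.sum_nonneg fun _ _ => abs_nonneg _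
  refine ⟨(M + M * ⌈C ^ 2⌉).toNat + 1, fun z hz hzs => ?_⟩
  obtain ⟨a, ha, hza⟩ := hs hzs
  have h1 : ∑ i, (z i - a i) ^ 2 ≤ ⌈C ^ 2⌉ := by
    exact_mod_cast hza.trans (Int.le_ceil _)
  have h2 : |q ⬝ᵥ (z - a)| ≤ M * ⌈C ^ 2⌉ := by
    rw [dotProduct, hM, Finset.sum_mul]
    refine (Finset.abs_sum_le_sum_abs _ _).trans (Finset.sum_le_sum fun i _ => ?_)
    rw [abs_mul]
    refine mul_le_mul_of_nonneg_left (le_trans ?_ h1) (abs_nonneg _)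
    refine le_trans ?_ (Finset.single_le_sum (f := fun i => (z i - a i) ^ 2)
      (fun _ _ => sq_nonneg _) (Finset.mem_univ i))
    rw [← sq_abs]
    exact Int.le_self_sq _
  have h3 : ¬ (M ≤ q ⬝ᵥ a ∨ q ⬝ᵥ a ≤ -M) := fun h => ha (by
    rw [laplacian_comp_dotProduct q fun s => min 0 s]
    exact lineLaplacian_min_eq_zero q h)
  rw [dotProduct_sub] at h2
  have h4 := abs_le.1 h2
  generalize M * ⌈C ^ 2⌉ = X at *
  push_cast at hz
  omega

theorem strip_subset_neighborhood {n : ℕ} {q v : Lattice n} (hv : q ⬝ᵥ v = 1) (K : ℕ) :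
    ∃ C : ℝ, 0 < C ∧ {z | ¬ ((K : ℤ) ≤ q ⬝ᵥ z ∨ q ⬝ᵥ z ≤ -K)} ⊆
      neighborhood C (deviationSet fun z => min 0 (q ⬝ᵥ z)) := by
  set S := ∑ i, v i ^ 2 with hS
  have hS0 : 0 ≤ S := Finset.sum_nonneg fun _ _ => sq_nonneg _
  refine ⟨(((K : ℤ) ^ 2 * S + 1 : ℤ) : ℝ), by positivity, fun z hz => ?_⟩
  -- This point lies on `q ⬝ᵥ a = 0`, where the Laplacian is negative, at distance `|q ⬝ᵥ z|` times
  -- the length of `v`.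
  refine ⟨z - (q ⬝ᵥ z) • v, ?_, ?_⟩
  · change laplacian (fun z => (fun s => min 0 s) (q ⬝ᵥ z)) _ ≠ 0
    rw [laplacian_comp_dotProduct, dotProduct_sub, dotProduct_smul, hv, smul_eq_mul, mul_one,
      sub_self]
    have hlt : lineLaplacian q (fun s => min 0 s) 0 < 0 := by
      obtain ⟨i, hi⟩ : ∃ i, q i ≠ 0 := by
        by_contra! h
        simp [dotProduct, h] at hv
      refine Finset.sum_neg' (fun j _ => ?_) ⟨i, Finset.mem_univ i, ?_⟩
      · simp only; omega
      · simp only; omega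
    exact hlt.ne
  · have h1 : ∑ i, (z i - (z - (q ⬝ᵥ z) • v) i) ^ 2 = (q ⬝ᵥ z) ^ 2 * S := by
      rw [hS, Finset.mul_sum]
      refine Finset.sum_congr rfl fun i _ => ?_
      simp only [Pi.sub_apply, Pi.smul_apply, smul_eq_mul]
      ring
    rw [h1]
    have h2 : (q ⬝ᵥ z) ^ 2 * S ≤ (K : ℤ) ^ 2 * S := by
      simp only [Set.mem_ofPred_eq] at hz
      refine mul_le_mul_of_nonneg_right ?_ hS0
      exact sq_le_sq' (by omega) (by omega)
    have h3 : (q ⬝ᵥ z) ^ 2 * S ≤ ((K : ℤ) ^ 2 * S + 1) ^ 2 := by nlinarith [sq_nonneg (K : ℤ)]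
    exact_mod_cast h3

theorem mem_theta_of_strip {n : ℕ} {q v : Lattice n} (hv : q ⬝ᵥ v = 1) {G : Lattice n → ℤ}
    (hG : ∀ z, laplacian G z ≤ 0) {k : ℤ} (hk : ∀ z, min 0 (q ⬝ᵥ z) - k ≤ G z)
    (hle : ∀ z, G z ≤ min 0 (q ⬝ᵥ z)) {K : ℕ}
    (hK : ∀ z, ↑K ≤ q ⬝ᵥ z ∨ q ⬝ᵥ z ≤ -K → G z = min 0 (q ⬝ᵥ z)) :
    G ∈ ⋃ k : ℕ, Theta k fun z => min 0 (q ⬝ᵥ z) := by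
  obtain ⟨C, hC0, hC⟩ := strip_subset_neighborhood hv K
  refine Set.mem_iUnion.2 ⟨k.toNat, hG, fun z => ⟨?_, hle z⟩, C, hC0, fun z hz => hC ?_⟩
  · have := hk z
    simp only
    omega
  · exact fun h => hz (hK z h).symm

/-- The canonical husking of `z ↦ min 0 (q ⬝ᵥ z)` is a function of `q ⬝ᵥ z`. -/
theorem IsLeastProfile.isCanonicalHusking {n : ℕ} {q v : Lattice n} (hv : q ⬝ᵥ v = 1)
    {g : ℤ → ℤ} (hg : IsLeastProfile q g) :
    IsCanonicalHusking (fun z => min 0 (q ⬝ᵥ z)) fun z => g (q ⬝ᵥ z) := by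
  constructor
  · obtain ⟨K, hK⟩ := hg.tails
    obtain ⟨k, hk⟩ := hg.tails.exists_min_sub_le hg.profile
    exact mem_theta_of_strip hv
      (fun z => by rw [laplacian_comp_dotProduct]; exact hg.superharmonic _)
      (fun z => hk _) (fun z => hg.profile.le_min hg.tails _) (fun z hz => hK _ hz)
  · intro G hG
    obtain ⟨k, hGs, hGk, C, -, hC⟩ := Set.mem_iUnion.1 hG
    obtain ⟨K, hK⟩ := exists_strip hC
    have hsurj : ∀ t : ℤ, q ⬝ᵥ (t • v) = t := fun t => by
      rw [dotProduct_smul, hv, smul_eq_mul, mul_one]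
    -- `h` is the minimum of `G` on each level of `q ⬝ᵥ z`. At a minimizing point its Laplacian is
    -- at most that of `G`.
    choose h hh using fun t : ℤ => isLeast_exists (s := {x | ∃ z, q ⬝ᵥ z = t ∧ G z = x})
      ⟨_, t • v, hsurj t, rfl⟩ (b := min 0 t - k) (by
        rintro _ ⟨z, rfl, rfl⟩
        exact (hGk z).1)
    have hle : ∀ z, h (q ⬝ᵥ z) ≤ G z := fun z => (hh _).2 ⟨z, rfl, rfl⟩
    intro z
    refine (hg.le_of h k (fun t => ?_) (fun t => ?_) ⟨K, fun t ht => ?_⟩ _).trans (hle z)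
    · obtain ⟨z, rfl, hz⟩ := (hh t).1
      refine le_trans ?_ (hGs z)
      rw [← laplacian_comp_dotProduct]
      exact laplacian_mono hz.symm hle
    · obtain ⟨z, rfl, hz⟩ := (hh t).1
      rw [← hz]
      exact (hGk z).1
    · obtain ⟨z, rfl, hz⟩ := (hh t).1
      rw [← hz]
      exact (not_not.1 (hK z ht)).symm

/-- The canonical husking lies below all functions of the right shape. -/
theorem IsCanonicalHusking.le_of_strip {n : ℕ} {q v : Lattice n} (hv : q ⬝ᵥ v = 1)
    {ψ G : Lattice n → ℤ} (hψ : IsCanonicalHusking (fun z => min 0 (q ⬝ᵥ z)) ψ)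
    (hG : ∀ z, laplacian G z ≤ 0) {k : ℤ} (hk : ∀ z, min 0 (q ⬝ᵥ z) - k ≤ G z)
    (hle : ∀ z, G z ≤ min 0 (q ⬝ᵥ z)) {K : ℕ}
    (hK : ∀ z, ↑K ≤ q ⬝ᵥ z ∨ q ⬝ᵥ z ≤ -K → G z = min 0 (q ⬝ᵥ z)) (z : Lattice n) : ψ z ≤ G z :=
  hψ.2 (mem_theta_of_strip hv hG hk hle hK) z

open Classical in
/-- The canonical husking defines a state. -/
theorem IsCanonicalHusking.state_nonneg {n : ℕ} {q v : Lattice n} (hv : q ⬝ᵥ v = 1)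
    {ψ : Lattice n → ℤ} (hψ : IsCanonicalHusking (fun z => min 0 (q ⬝ᵥ z)) ψ) (z : Lattice n) :
    0 ≤ 2 * (n : ℤ) - 1 + laplacian ψ z := by
  -- Otherwise the Laplacian at `z` is at most `-2n`, and lowering `ψ` by 1 at `z` alone keeps it
  -- superharmonic, against minimality.
  by_contra! hneg
  obtain ⟨k, hs, hk, C, -, hC⟩ := Set.mem_iUnion.1 hψ.1
  obtain ⟨K, hK⟩ := exists_strip hC
  have hnn : ∀ y, 0 ≤ (if y = z then (1 : ℤ) else 0) ∧ (if y = z then (1 : ℤ) else 0) ≤ 1 :=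
    fun y => by split_ifs <;> norm_num
  have := hψ.le_of_strip hv (G := fun y => ψ y - if y = z then 1 else 0) (k := k + 1)
    (K := max K ((q ⬝ᵥ z).natAbs + 1)) (fun y => ?_) (fun y => ?_) (fun y => ?_)
    (fun y hy => ?_) z
  · simp at this
  · have hlap : -(2 * (n : ℤ)) * (if y = z then 1 else 0) ≤
        laplacian (fun y => if y = z then 1 else 0) y := by
      rw [laplacian]
      exact le_add_of_nonneg_right (Finset.sum_nonneg fun i _ => add_nonneg (hnn _).1 (hnn _).1)
    rw [laplacian_sub]
    by_cases hy : y = z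
    · subst hy
      simp only [if_true] at hlap
      linarith
    · simp only [hy, if_false] at hlap
      linarith [hs y]
  · have h1 := (hk y).1
    have h2 := hnn y
    simp only at h1
    omega
  · have h1 := (hk y).2
    have h2 := hnn y
    simp only at h1
    omega
  · have hyz : y ≠ z := by
      rintro rfl
      omega
    rw [if_neg hyz, sub_zero]
    exact (not_not.1 (hK y (by omega))).symm

/-! ### Waves -/

open Classical in
/-- The number of topplings at each vertex when the topplings prescribed by `s` up to time `m` are
done after a first toppling at `x₀`. -/
noncomputable def odometer {n : ℕ} (x₀ : Lattice n) (s : ℕ → Option (Lattice n)) :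
    ℕ → Lattice n → ℤ
  | 0 => fun z => if z = x₀ then 1 else 0
  | m + 1 => match s m with
    | none => odometer x₀ s m
    | some x => fun z => odometer x₀ s m z + if z = x then 1 else 0

theorem run_topple_eq {n : ℕ} (φ : Lattice n → ℤ) (x₀ : Lattice n) (s : ℕ → Option (Lattice n))
    (m : ℕ) (z : Lattice n) :
    run (topple φ x₀) s m z = φ z + laplacian (odometer x₀ s m) z := by
  induction m generalizing z with
  | zero => exact topple_eq φ x₀ z
  | succ m ih =>
    rw [run, odometer]
    cases s m with
    | none => exact ih z
    | some x =>
      simp only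
      rw [topple_eq, ih, laplacian_add, add_assoc]

theorem odometer_mono {n : ℕ} (x₀ : Lattice n) (s : ℕ → Option (Lattice n)) (z : Lattice n) :
    Monotone fun m => odometer x₀ s m z := by
  refine monotone_nat_of_le_succ fun m => ?_
  rw [odometer]
  cases s m with
  | none => exact le_rfl
  | some x => simp only; split_ifs <;> linarith

theorem odometer_nonneg {n : ℕ} (x₀ : Lattice n) (s : ℕ → Option (Lattice n)) (m : ℕ)
    (z : Lattice n) : 0 ≤ odometer x₀ s m z := by
  refine le_trans ?_ (odometer_mono x₀ s z (Nat.zero_le m))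
  simp only [odometer]
  split_ifs <;> norm_num

theorem one_le_odometer {n : ℕ} (x₀ : Lattice n) (s : ℕ → Option (Lattice n)) (m : ℕ) :
    1 ≤ odometer x₀ s m x₀ := by
  refine le_trans ?_ (odometer_mono x₀ s x₀ (Nat.zero_le m))
  simp [odometer]

/-- The least action principle for waves. -/
theorem odometer_le {n : ℕ} {φ : Lattice n → ℤ} {x₀ : Lattice n} {s : ℕ → Option (Lattice n)}
    (hs : ∀ m x, s m = some x → 2 * (n : ℤ) ≤ run (topple φ x₀) s m x)
    {w : Lattice n → ℤ} (hw : ∀ z, 0 ≤ w z) (hw₀ : 1 ≤ w x₀)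
    (hstab : ∀ z, φ z + laplacian w z ≤ 2 * (n : ℤ) - 1) (m : ℕ) (z : Lattice n) :
    odometer x₀ s m z ≤ w z := by
  induction m generalizing z with
  | zero =>
    simp only [odometer]
    split_ifs with h
    · rw [h]; exact hw₀
    · exact hw z
  | succ m ih =>
    rw [odometer]
    cases hsm : s m with
    | none => exact ih z
    | some x =>
      simp only
      split_ifs with h
      · subst h
        -- At a vertex where the odometer has reached `w`, its Laplacian is at most that of `w`, so
        -- stability of `w` rules out a legal toppling.
        have hlt : odometer x₀ s m z ≠ w z := fun h => by
          have h1 := hs m z hsm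
          rw [run_topple_eq] at h1
          have h2 := laplacian_mono h ih
          linarith [hstab z]
        have := lt_of_le_of_ne (ih z) hlt
        linarith
      · rw [add_zero]; exact ih z

/-- If no vertex topples twice, the numbers of topplings stabilize. -/
theorem exists_odometer_limit {n : ℕ} {x₀ : Lattice n} {s : ℕ → Option (Lattice n)}
    (h1 : ∀ m z, odometer x₀ s m z ≤ 1) :
    ∃ u : Lattice n → ℤ, (∀ z, u z = 0 ∨ u z = 1) ∧ u x₀ = 1 ∧
      ∀ z, ∀ᶠ m in Filter.atTop, odometer x₀ s m z = u z := by
  have key : ∀ z, ∃ a : ℤ, (a = 0 ∨ a = 1) ∧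
      ∀ᶠ m in Filter.atTop, odometer x₀ s m z = a := fun z => by
    by_cases h : ∃ m, odometer x₀ s m z = 1
    · obtain ⟨m, hm⟩ := h
      refine ⟨1, Or.inr rfl, Filter.eventually_atTop.2 ⟨m, fun k hk => ?_⟩⟩
      refine le_antisymm (h1 k z) ?_
      rw [← hm]
      exact odometer_mono x₀ s z hk
    · push Not at h
      refine ⟨0, Or.inl rfl, Filter.Eventually.of_forall fun m => ?_⟩
      have := lt_of_le_of_ne (h1 m z) (h m)
      have := odometer_nonneg x₀ s m z
      omega
  choose u hu01 hu using key
  refine ⟨u, hu01, ?_, hu⟩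
  obtain ⟨m, hm⟩ := (hu x₀).exists
  have := one_le_odometer x₀ s m
  rcases hu01 x₀ with h | h <;> omega

theorem eventually_laplacian_eq {n : ℕ} {F : ℕ → Lattice n → ℤ} {u : Lattice n → ℤ}
    (h : ∀ z, ∀ᶠ m in Filter.atTop, F m z = u z) (z : Lattice n) :
    ∀ᶠ m in Filter.atTop, laplacian (F m) z = laplacian u z := by
  have h1 : ∀ᶠ m in Filter.atTop, ∀ i, F m (z + Pi.single i 1) = u (z + Pi.single i 1) ∧
      F m (z - Pi.single i 1) = u (z - Pi.single i 1) :=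
    Filter.eventually_all.2 fun i => (h _).and (h _)
  filter_upwards [h1, h z] with m hm hz
  exact laplacian_congr hz hm

/-- A wave topples each vertex at most once, and its set of toppled vertices is minimal. -/
theorem exists_wave_set {n : ℕ} {φ τ : Lattice n → ℤ} {x₀ : Lattice n}
    (hφ : ∀ z, φ z ≤ 2 * (n : ℤ) - 1) (h : RelaxesTo (topple φ x₀) τ) :
    ∃ u : Lattice n → ℤ, (∀ z, u z = 0 ∨ u z = 1) ∧ u x₀ = 1 ∧
      (∀ z, τ z = φ z + laplacian u z) ∧
      ∀ w : Lattice n → ℤ, (∀ z, 0 ≤ w z) → 1 ≤ w x₀ →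
        (∀ z, φ z + laplacian w z ≤ 2 * (n : ℤ) - 1) → ∀ z, u z ≤ w z := by
  obtain ⟨s, hs, hlim, -⟩ := h
  -- Toppling every vertex once changes nothing, so the constant 1 is stabilizing and bounds the
  -- odometer.
  obtain ⟨u, hu01, hu0, hu⟩ := exists_odometer_limit (x₀ := x₀) (s := s) fun m z =>
    odometer_le hs (w := fun _ => 1) (fun _ => zero_le_one) le_rfl
      (fun z => by rw [laplacian_const, add_zero]; exact hφ z) m z
  refine ⟨u, hu01, hu0, fun z => ?_, fun w h0 h1 hw z => ?_⟩
  · obtain ⟨M, hM⟩ := hlim z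
    obtain ⟨m, hm, hle⟩ :=
      ((eventually_laplacian_eq hu z).and (Filter.eventually_ge_atTop M)).exists
    rw [← hM m hle, run_topple_eq, hm]
  · obtain ⟨m, hm⟩ := (hu z).exists
    rw [← hm]
    exact odometer_le hs h0 h1 hw m z

open Classical in
/-- The configurations obtained by toppling, at time `m`, the vertex `e m` if this is legal. -/
noncomputable def greedyRun {n : ℕ} (σ : Lattice n → ℤ) (e : ℕ → Lattice n) : ℕ → Lattice n → ℤ
  | 0 => σ
  | m + 1 => if 2 * (n : ℤ) ≤ greedyRun σ e m (e m) then topple (greedyRun σ e m) (e m)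
      else greedyRun σ e m

open Classical in
theorem run_greedy {n : ℕ} (σ : Lattice n → ℤ) (e : ℕ → Lattice n) (m : ℕ) :
    run σ (fun m => if 2 * (n : ℤ) ≤ greedyRun σ e m (e m) then some (e m) else none) m =
      greedyRun σ e m := by
  induction m with
  | zero => rfl
  | succ m ih =>
    rw [run, greedyRun]
    by_cases h : 2 * (n : ℤ) ≤ greedyRun σ e m (e m)
    · simp only [h, if_true]
      rw [ih]
    · simp only [h, if_false]
      exact ih

/-- If the vertices with `w = 1` form a minimal set whose toppling is stable, they are the ones
toppled by the wave from `x₀`. -/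
theorem relaxesTo_of_minimal {n : ℕ} {φ w : Lattice n → ℤ} {x₀ : Lattice n}
    (hw : ∀ z, w z = 0 ∨ w z = 1) (hw₀ : w x₀ = 1)
    (hstab : ∀ z, φ z + laplacian w z ≤ 2 * (n : ℤ) - 1)
    (hmin : ∀ u : Lattice n → ℤ, (∀ z, u z = 0 ∨ u z = 1) → u x₀ = 1 → (∀ z, u z ≤ w z) →
      (∀ z, φ z + laplacian u z ≤ 2 * (n : ℤ) - 1) → ∀ z, u z = w z) :
    RelaxesTo (topple φ x₀) fun z => φ z + laplacian w z := by
  classical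
  obtain ⟨f, hf⟩ := exists_surjective_nat (Lattice n)
  -- Unpairing makes the enumeration visit every vertex infinitely often, so a vertex unstable in
  -- the limit would topple again.
  set e : ℕ → Lattice n := fun m => f m.unpair.1 with he
  have hfreq : ∀ z M, ∃ m, M ≤ m ∧ e m = z := fun z M => by
    obtain ⟨k, hk⟩ := hf z
    exact ⟨Nat.pair k M, Nat.right_le_pair k M, by simp [he, hk]⟩
  set s : ℕ → Option (Lattice n) := fun m =>
    if 2 * (n : ℤ) ≤ greedyRun (topple φ x₀) e m (e m) then some (e m) else none with hsdef
  have hrun : ∀ m, run (topple φ x₀) s m = greedyRun (topple φ x₀) e m :=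
    run_greedy (topple φ x₀) e
  have hlegal : ∀ m x, s m = some x → 2 * (n : ℤ) ≤ run (topple φ x₀) s m x := by
    intro m x hx
    rw [hrun]
    simp only [hsdef] at hx
    split_ifs at hx with h
    obtain rfl := Option.some.inj hx
    exact h
  have hle : ∀ m z, odometer x₀ s m z ≤ w z := fun m z =>
    odometer_le hlegal (fun z => by rcases hw z with h | h <;> omega) hw₀.ge hstab m z
  obtain ⟨u, hu01, hu0, hu⟩ := exists_odometer_limit (x₀ := x₀) (s := s) fun m z =>
    (hle m z).trans (by rcases hw z with h | h <;> omega)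
  have hrunlim : ∀ z, ∀ᶠ m in Filter.atTop, run (topple φ x₀) s m z = φ z + laplacian u z :=
    fun z => (eventually_laplacian_eq hu z).mono fun m hm => by rw [run_topple_eq, hm]
  have hustab : ∀ z, φ z + laplacian u z ≤ 2 * (n : ℤ) - 1 := by
    intro z
    by_contra! hcon
    obtain ⟨M, hM⟩ := Filter.eventually_atTop.1 ((hu z).and (hrunlim z))
    obtain ⟨m, hMm, hem⟩ := hfreq z M
    have hsm : s m = some z := by
      simp only [hsdef]
      rw [hem, if_pos]
      rw [← hrun, (hM m hMm).2]
      linarith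
    have h1 : odometer x₀ s (m + 1) z = odometer x₀ s m z + 1 := by
      rw [odometer, hsm]
      simp
    rw [(hM m hMm).1, (hM (m + 1) (by omega)).1] at h1
    omega
  have huw : u = w := funext (hmin u hu01 hu0 (fun z => by
    obtain ⟨m, hm⟩ := (hu z).exists
    rw [← hm]
    exact hle m z) hustab)
  rw [← huw]
  exact ⟨s, hlegal, fun z => Filter.eventually_atTop.1 (hrunlim z), hustab⟩

/-! ### The soliton of a direction -/

/-- In a half-space of vertices with `2n - 1` grains a wave topples all vertices or none. -/
theorem eq_one_of_full_halfspace {n : ℕ} {q : Lattice n} {c : ℤ} {σ u : Lattice n → ℤ}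
    (hσ : ∀ z, q ⬝ᵥ z ≤ c → σ z = 2 * (n : ℤ) - 1) (hu : ∀ z, u z = 0 ∨ u z = 1)
    (hstab : ∀ z, σ z + laplacian u z ≤ 2 * (n : ℤ) - 1) {z y : Lattice n}
    (hz : q ⬝ᵥ z ≤ c) (hy : q ⬝ᵥ y ≤ c) (h : u z = 1) : u y = 1 := by
  have key : ∀ y, q ⬝ᵥ y ≤ c → u y = 0 → ∀ i, u (y + Pi.single i 1) = 0 ∧
      u (y - Pi.single i 1) = 0 := fun y hy h0 i => by
    rw [← h0]
    refine eq_of_laplacian_nonpos (by linarith [hstab y, hσ y hy]) (fun j => ?_) i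
    rw [h0]
    constructor
    · rcases hu (y + Pi.single j 1) with h | h <;> omega
    · rcases hu (y - Pi.single j 1) with h | h <;> omega
  refine halfspace_connected q c (fun z => u z = 1) (fun z i hz h => ⟨fun h' => ?_, fun h' => ?_⟩)
    hz hy h
  · refine (hu _).resolve_left fun h0 => ?_
    have := (key _ h' h0 i).2
    rw [add_sub_cancel_right] at this
    omega
  · refine (hu _).resolve_left fun h0 => ?_
    have := (key _ h' h0 i).1
    rw [sub_add_cancel] at this
    omega

theorem exists_ne_zero_of_dotProduct_eq_one {n : ℕ} {q v : Lattice n} (hv : q ⬝ᵥ v = 1) :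
    ∃ i, q i ≠ 0 := by
  by_contra! h
  simp [dotProduct, h] at hv

theorem IsLeastProfile.exists_harmonic_outside {n : ℕ} {q : Lattice n} {g : ℤ → ℤ}
    (hg : IsLeastProfile q g) :
    ∃ c : ℕ, ∀ t : ℤ, ↑c ≤ t ∨ t ≤ -c → g t = min 0 t ∧ lineLaplacian q g t = 0 := by
  obtain ⟨K, hK⟩ := hg.tails
  have hM0 : 0 ≤ ∑ j, |q j| := Finset.sum_nonneg fun _ _ => abs_nonneg _
  refine ⟨K + (∑ j, |q j|).toNat, fun t ht => ⟨hK t (by omega), ?_⟩⟩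
  refine Finset.sum_eq_zero fun i _ => ?_
  have h := abs_le.1 (abs_le_sum_abs q i)
  rw [hK t (by omega), hK (t + q i) (by omega), hK (t - q i) (by omega)]
  omega

theorem dotProduct_add_smul {n : ℕ} (q z v : Lattice n) (k : ℤ) :
    q ⬝ᵥ (z + k • v) = q ⬝ᵥ z + k * (q ⬝ᵥ v) := by
  rw [dotProduct_add, dotProduct_smul, smul_eq_mul]

/-- The wave is `ψ (z + v) - ψ z`, with values 0 and 1. If `u` below it also stabilizes, then `ψ +
u` shifted back by `v` competes with `ψ`, which makes `u` no smaller. -/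
theorem IsLeastProfile.isMovableBy {n : ℕ} {q v : Lattice n} (hv : q ⬝ᵥ v = 1) {g : ℤ → ℤ}
    (hg : IsLeastProfile q g) {φ : Lattice n → ℕ}
    (hφ : ∀ z, (φ z : ℤ) = 2 * n - 1 + lineLaplacian q g (q ⬝ᵥ z)) : IsMovableBy v φ := by
  have hψ := hg.isCanonicalHusking hv
  obtain ⟨c, hc⟩ := hg.exists_harmonic_outside
  obtain ⟨k, hk⟩ := hg.tails.exists_min_sub_le hg.profile
  obtain ⟨i₀, -⟩ := exists_ne_zero_of_dotProduct_eq_one hv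
  have hlap : ∀ z, laplacian (fun y => g (q ⬝ᵥ y)) z = lineLaplacian q g (q ⬝ᵥ z) :=
    laplacian_comp_dotProduct q g
  have hadd : ∀ z, q ⬝ᵥ (z + v) = q ⬝ᵥ z + 1 := fun z => by rw [dotProduct_add, hv]
  have hsurj : ∀ t : ℤ, q ⬝ᵥ (t • v) = t := fun t => by
    rw [dotProduct_smul, hv, smul_eq_mul, mul_one]
  have hfull : ∀ z, q ⬝ᵥ z ≤ -c → (φ z : ℤ) = 2 * n - 1 := fun z hz => by
    rw [hφ, (hc _ (Or.inr hz)).2, add_zero]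
  constructor
  · set w : Lattice n → ℤ := fun z => g (q ⬝ᵥ (z + v)) - g (q ⬝ᵥ z) with hw
    have hw01 : ∀ z, w z = 0 ∨ w z = 1 := fun z => by
      have := hg.profile.succ (q ⬝ᵥ z)
      simp only [hw, hadd]
      omega
    have hwlap : ∀ z, (φ z : ℤ) + laplacian w z = φ (z + v) := fun z => by
      rw [hw, laplacian_sub, laplacian_translate (fun y => g (q ⬝ᵥ y)), hlap, hlap, hφ, hφ]
      ring
    have hM := abs_le.1 (abs_le_sum_abs q i₀)
    -- So far to the left that the neighbour `z₀ + Pi.single i₀ 1` also has `2n - 1` grains.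
    set z₀ : Lattice n := (-(c + 1 + ∑ j, |q j|) : ℤ) • v with hz₀
    have hz₀q : q ⬝ᵥ z₀ = -(c + 1 + ∑ j, |q j|) := hsurj _
    have hM0 : 0 ≤ ∑ j, |q j| := Finset.sum_nonneg fun _ _ => abs_nonneg _
    refine ⟨z₀, hfull _ (by omega), ⟨z₀ + Pi.single i₀ 1, (adj_iff _ _).2 ⟨i₀, Or.inl rfl⟩,
      hfull _ ?_⟩, ?_⟩
    · rw [dotProduct_add, dotProduct_single_one']
      omega
    · have hstab : ∀ z, (φ z : ℤ) + laplacian w z ≤ 2 * n - 1 := fun z => by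
        rw [hwlap, hφ]
        linarith [hg.superharmonic (q ⬝ᵥ (z + v))]
      have hw₀ : w z₀ = 1 := by
        simp only [hw, hadd]
        rw [(hc _ (by omega)).1, (hc _ (by omega)).1]
        omega
      have hrel := relaxesTo_of_minimal (φ := fun z => (φ z : ℤ)) hw01 hw₀ hstab ?_
      · simp only [hwlap] at hrel
        exact hrel
      · intro u hu01 hu₀ hule hustab
        have hfar : ∀ z, q ⬝ᵥ z ≤ -c → u z = 1 := fun z hz =>
          eq_one_of_full_halfspace hfull hu01 hustab (by omega : q ⬝ᵥ z₀ ≤ -c) hz hu₀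
        have hle : ∀ z, g (q ⬝ᵥ z) ≤ g (q ⬝ᵥ (z + -v)) + u (z + -v) := by
          have hneg : ∀ z, q ⬝ᵥ (z + -v) = q ⬝ᵥ z - 1 := fun z => by
            rw [dotProduct_add, dotProduct_neg, hv]; ring
          have hupper : ∀ z, g (q ⬝ᵥ (z + -v)) + u (z + -v) ≤ g (q ⬝ᵥ z) := fun z => by
            have := hule (z + -v)
            simp only [hw, neg_add_cancel_right] at this
            linarith
          have hlower : ∀ z, 0 ≤ u (z + -v) := fun z => by
            rcases hu01 (z + -v) with h | h <;> omega
          refine hψ.le_of_strip hv (k := k + 1) (K := c + 1) (fun z => ?_) (fun z => ?_)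
            (fun z => ?_) (fun z hz => ?_)
          · rw [laplacian_translate (fun y => g (q ⬝ᵥ y) + u y), laplacian_add, hlap]
            have := hustab (z + -v)
            rw [hφ] at this
            linarith
          · have := hk (q ⬝ᵥ (z + -v))
            have := hlower z
            rw [hneg] at *
            omega
          · exact (hupper z).trans (hg.profile.le_min hg.tails _)
          · have h1 := hupper z
            have h2 := hlower z
            rw [hneg] at *
            rcases hz with hz | hz
            · rw [(hc _ (by omega)).1] at h1 ⊢
              rw [(hc _ (by omega)).1] at h1
              omega
            · rw [hfar _ (by rw [hneg]; omega), (hc _ (by omega)).1]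
              omega
        intro z
        have h1 := hle (z + v)
        rw [add_neg_cancel_right] at h1
        have h2 := hule z
        simp only [hw] at h2 ⊢
        linarith
  -- Periodicity carries every point into the harmonic region, so `ψ` would be harmonic and bounded
  -- above, hence constant, against its left tail.
  · intro hper
    have hstep : ∀ k : ℕ, ∀ z, φ (z + (k : ℤ) • v) = φ z := by
      intro k
      induction k with
      | zero => simp
      | succ k ih =>
        intro z
        rw [← ih z, hper (z + (k : ℤ) • v)]
        push_cast
        rw [add_smul, one_smul, add_assoc]
    have hall : ∀ z, lineLaplacian q g (q ⬝ᵥ z) = 0 := fun z => by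
      have h1 := hstep (c + (q ⬝ᵥ z).natAbs) z
      have h2 := hφ z
      have h3 := hφ (z + ((c + (q ⬝ᵥ z).natAbs : ℕ) : ℤ) • v)
      rw [dotProduct_add_smul, hv, mul_one, (hc _ (by omega)).2, h1] at h3
      linarith
    have hconst := superharmonic_const (F := fun z => -1 * g (q ⬝ᵥ z)) (b := 0)
      (fun z => by rw [laplacian_const_mul (-1) fun z => g (q ⬝ᵥ z), hlap, hall]; norm_num)
      (fun z => by have := hg.profile.nonpos hg.tails (q ⬝ᵥ z); linarith)
      ((-c : ℤ) • v) ((-c - 1 : ℤ) • v)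
    simp only [hsurj] at hconst
    rw [(hc _ (by omega)).1, (hc _ (by omega)).1] at hconst
    omega

theorem finrank_orthogonal {n : ℕ} {q v : Lattice n} (hv : q ⬝ᵥ v = 1) :
    Module.finrank ℤ (LinearMap.ker (dotProductBilin ℤ ℤ q : Lattice n →ₗ[ℤ] ℤ)) + 1 = n := by
  set f : Lattice n →ₗ[ℤ] ℤ := dotProductBilin ℤ ℤ q
  have hf : Function.Surjective f := fun t => ⟨t • v, by
    rw [map_smul]
    change t • (q ⬝ᵥ v) = t
    rw [hv, smul_eq_mul, mul_one]⟩
  have h1 := Submodule.finrank_quotient_add_finrank (LinearMap.ker f)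
  rw [(f.quotKerEquivOfSurjective hf).finrank_eq, Module.finrank_self, Module.finrank_fin_fun] at h1
  rwa [add_comm]

theorem IsLeastProfile.isSoliton {n : ℕ} {q v : Lattice n} (hv : q ⬝ᵥ v = 1) {g : ℤ → ℤ}
    (hg : IsLeastProfile q g) {φ : Lattice n → ℕ}
    (hφ : ∀ z, (φ z : ℤ) = 2 * n - 1 + lineLaplacian q g (q ⬝ᵥ z)) : IsSoliton q φ := by
  refine ⟨⟨_, finrank_orthogonal hv, fun z p hp => ?_⟩, ?_, v, ?_, hg.isMovableBy hv hφ⟩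
  · have hp' : q ⬝ᵥ p = 0 := hp
    have h1 := hφ z
    have h2 := hφ (z + p)
    rw [dotProduct_add, hp', add_zero, ← h1] at h2
    exact_mod_cast h2.symm
  · obtain ⟨c, hc⟩ := hg.exists_harmonic_outside
    refine ⟨-c, c, fun z hz => ?_⟩
    by_contra hcon
    exact hz (by rw [hφ, (hc _ (by omega)).2, add_zero])
  · rintro rfl
    simp at hv

/-! ### Uniqueness of the soliton -/

/-- A superharmonic function `F` with the shape of the canonical husking is equal to it if
`F (· + v)` is the least superharmonic function above `F` that is larger than `F` at `x₀`. -/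
theorem IsLeastProfile.eq_of_wave {n : ℕ} {q v : Lattice n} (hv : q ⬝ᵥ v = 1) {g : ℤ → ℤ}
    (hg : IsLeastProfile q g) {F : Lattice n → ℤ} (hF : ∀ z, laplacian F z ≤ 0)
    (hle : ∀ z, F z ≤ min 0 (q ⬝ᵥ z)) {k : ℤ} (hk : ∀ z, min 0 (q ⬝ᵥ z) - k ≤ F z) {K : ℕ}
    (hK : ∀ z, ↑K ≤ q ⬝ᵥ z ∨ q ⬝ᵥ z ≤ -K → F z = min 0 (q ⬝ᵥ z))
    (hstep : ∀ z, F (z + v) = F z ∨ F (z + v) = F z + 1) {x₀ : Lattice n}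
    (hx₀ : laplacian F x₀ = 0)
    (hmin : ∀ G : Lattice n → ℤ, (∀ z, laplacian G z ≤ 0) → (∀ z, F z ≤ G z) → F x₀ < G x₀ →
      ∀ z, F (z + v) ≤ G z) (z : Lattice n) : F z = g (q ⬝ᵥ z) := by
  have hlow := (hg.isCanonicalHusking hv).le_of_strip hv hF hk hle hK
  have hdot : ∀ z (j : ℤ), q ⬝ᵥ (z + j • v) = q ⬝ᵥ z + j := fun z j => by
    rw [dotProduct_add_smul, hv, mul_one]
  have hback : ∀ (N : ℕ) z, F z ≤ F (z + (-N : ℤ) • v) + N := by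
    intro N
    induction N with
    | zero => simp
    | succ N ih =>
      intro z
      have h1 := ih z
      have h2 := hstep (z + (-(N + 1 : ℕ) : ℤ) • v)
      rw [show z + (-(N + 1 : ℕ) : ℤ) • v + v = z + (-N : ℤ) • v by push_cast; module] at h2
      push_cast at h2 ⊢
      omega
  have hslope : ∀ (i : ℕ) z, F z = q ⬝ᵥ z → F (z + (-i : ℤ) • v) = q ⬝ᵥ z - i := fun i z hz => by
    have h1 := hback i z
    have h2 := hle (z + (-i : ℤ) • v)
    rw [hdot] at h2
    omega
  -- Otherwise a translate `F (· - N • v) + N` is admissible in `hmin`. Far to the left it equals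
  -- `F`, whereas `F (· + v)` is larger by 1.
  have hFx₀ : F x₀ = q ⬝ᵥ x₀ := by
    have h1 := hback (K + (q ⬝ᵥ x₀).natAbs) x₀
    by_contra hne
    have h2 := hmin (fun z => F (z + (-(K + (q ⬝ᵥ x₀).natAbs : ℕ) : ℤ) • v) +
      (K + (q ⬝ᵥ x₀).natAbs : ℕ)) (fun z => by
        rw [laplacian_add, laplacian_const, add_zero, laplacian_translate]; exact hF _)
      (hback _) (lt_of_le_of_ne h1 fun h => hne (by
        rw [h, hK _ (by rw [hdot]; omega), hdot]; omega)) ((-(K + 1) : ℤ) • v)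
    have hd0 : q ⬝ᵥ ((-(K + 1) : ℤ) • v) = -(K + 1) := by
      rw [dotProduct_smul, hv, smul_eq_mul, mul_one]
    have hd1 : q ⬝ᵥ ((-(K + 1) : ℤ) • v + v) = -K := by
      rw [dotProduct_add, hd0, hv]; ring
    rw [hK _ (by rw [hd1]; omega), hK _ (by rw [hdot, hd0]; omega), hdot, hd0, hd1] at h2
    omega
  have hnbr := eq_of_contact (F := F) (G := fun z => q ⬝ᵥ z) (z := x₀)
    (fun z => (hle z).trans (min_le_right _ _)) hFx₀ (by rw [laplacian_dotProduct, hx₀])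
  obtain ⟨c, hc⟩ := hg.tails
  -- The least such `j` turns out to be 0, which together with `hlow` is the claim.
  have hex : ∃ j : ℕ, ∀ z, F z ≤ g (q ⬝ᵥ z + j) := by
    refine ⟨2 * c + K, fun z => ?_⟩
    have h1 := hle z
    by_cases h : -K ≤ q ⬝ᵥ z
    · rw [hc _ (by omega)]
      omega
    · have h2 := hlow z
      rw [hK z (by omega)] at h2 ⊢
      by_cases h3 : q ⬝ᵥ z + (2 * c + K : ℕ) ≤ -c ∨ (c : ℤ) ≤ q ⬝ᵥ z + (2 * c + K : ℕ)
      · rw [hc _ (by omega)]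
        omega
      · have h4 := hg.profile.1 (show -(c : ℤ) ≤ q ⬝ᵥ z + (2 * c + K : ℕ) by omega)
        rw [hc _ (by omega)] at h4
        omega
  classical
  have hj := Nat.find_spec hex
  rcases Nat.eq_zero_or_pos (Nat.find hex) with hj0 | hj0
  · rw [hj0] at hj
    have := hj z
    rw [Nat.cast_zero, add_zero] at this
    exact le_antisymm this (hlow z)
  · exfalso
    have hnot := Nat.find_min hex (Nat.sub_lt hj0 one_pos)
    set j := Nat.find hex
    have hXlap : ∀ z, laplacian (fun y => g (q ⬝ᵥ y + j)) z ≤ 0 := fun z => by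
      rw [laplacian_comp_dotProduct q fun t => g (t + j)]
      have := lineLaplacian_translate q g j 0 (q ⬝ᵥ z)
      simp only [add_zero] at this
      rw [this]
      exact hg.superharmonic _
    -- Without contact at `x₀`, `hmin` applied to this translate would give the bound for `j - 1`.
    have hcontact : g (q ⬝ᵥ x₀ + j) = q ⬝ᵥ x₀ := by
      by_contra hne
      refine hnot fun z => ?_
      have h1 := hmin _ hXlap hj (lt_of_le_of_ne (hj x₀) fun h => hne (by rw [← h, hFx₀]))
        (z + (-1 : ℤ) • v)
      rw [hdot, show z + (-1 : ℤ) • v + v = z by module] at h1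
      convert h1 using 2
      omega
    -- Going left from `x₀` by steps `v`, `g (t + j) - t` grows from 0 to `j > 0`. At the last point
    -- where it is 0, `F` touches the translate, hence also at the neighbours; but at a neighbour
    -- further left the two differ.
    have hexi : ∃ i : ℕ, q ⬝ᵥ x₀ - (i + 1) < g (q ⬝ᵥ x₀ - (i + 1) + j) := by
      refine ⟨j + c + (q ⬝ᵥ x₀).natAbs, ?_⟩
      rw [hc _ (by omega)]
      omega
    have hi := Nat.find_spec hexi
    have hi' : g (q ⬝ᵥ x₀ - (Nat.find hexi : ℕ) + j) ≤ q ⬝ᵥ x₀ - (Nat.find hexi : ℕ) := by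
      rcases Nat.eq_zero_or_pos (Nat.find hexi) with h0 | h0
      · rw [h0, Nat.cast_zero, sub_zero, hcontact]
      · have := Nat.find_min hexi (Nat.sub_lt h0 one_pos)
        rw [Nat.cast_pred h0, sub_add_cancel] at this
        linarith
    set i := Nat.find hexi
    set x₁ := x₀ + (-i : ℤ) • v with hx₁
    have hx₁q : q ⬝ᵥ x₁ = q ⬝ᵥ x₀ - i := by rw [hx₁, hdot]; ring
    have hFx₁ : F x₁ = q ⬝ᵥ x₁ := by rw [hslope i x₀ hFx₀, hx₁q]
    have hnbr₁ : ∀ l, F (x₁ + Pi.single l 1) = q ⬝ᵥ (x₁ + Pi.single l 1) ∧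
        F (x₁ - Pi.single l 1) = q ⬝ᵥ (x₁ - Pi.single l 1) := fun l => by
      have h1 := hslope i _ (hnbr l).1
      have h2 := hslope i _ (hnbr l).2
      rw [show x₀ + Pi.single l 1 + (-i : ℤ) • v = x₁ + Pi.single l 1 by rw [hx₁]; abel] at h1
      rw [show x₀ - Pi.single l 1 + (-i : ℤ) • v = x₁ - Pi.single l 1 by rw [hx₁]; abel] at h2
      rw [h1, h2]
      simp only [dotProduct_add, dotProduct_sub, hx₁q]
      constructor <;> ring
    have hFlap : laplacian F x₁ = 0 := by
      rw [← laplacian_dotProduct q x₁]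
      exact laplacian_congr hFx₁ hnbr₁
    have hX₁ : F x₁ = g (q ⬝ᵥ x₁ + j) :=
      le_antisymm (hj x₁) (by rw [hFx₁, hx₁q]; exact hi')
    have hXnbr := eq_of_contact (G := fun y => g (q ⬝ᵥ y + j)) hj hX₁ (by
      rw [hFlap]; exact hXlap x₁)
    have hlt : ∀ y, q ⬝ᵥ y < q ⬝ᵥ x₁ → F y = q ⬝ᵥ y → F y ≠ g (q ⬝ᵥ y + j) := fun y hy h1 h2 => by
      have h3 := hg.profile.2 (show q ⬝ᵥ y + j ≤ q ⬝ᵥ x₀ - (i + 1) + j by omega)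
      simp only at h3
      rw [h1] at h2
      omega
    obtain ⟨l, hl⟩ := exists_ne_zero_of_dotProduct_eq_one hv
    rcases lt_or_gt_of_ne hl with h | h
    · exact hlt (x₁ + Pi.single l 1) (by rw [dotProduct_add, dotProduct_single_one']; omega)
        (hnbr₁ l).1 (hXnbr l).1
    · exact hlt (x₁ - Pi.single l 1) (by rw [dotProduct_sub, dotProduct_single_one']; omega)
        (hnbr₁ l).2 (hXnbr l).2

/-! ### Shifts along the hyperplane -/

/-- A sublattice of rank `n - 1` orthogonal to `q` contains a multiple of every vector orthogonal
to `q`. -/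
theorem exists_smul_mem {n : ℕ} {q v₁ v : Lattice n} (hv₁ : q ⬝ᵥ v₁ = 1) (hv : q ⬝ᵥ v = 0)
    {L : Submodule ℤ (Lattice n)} (hL : Module.finrank ℤ L + 1 = n)
    (hLq : ∀ p ∈ L, q ⬝ᵥ p = 0) : ∃ N : ℕ, 0 < N ∧ (N : ℤ) • v ∈ L := by
  have h1 := Submodule.finrank_quotient_add_finrank L
  rw [Module.finrank_fin_fun] at h1
  -- The quotient by `L` has rank 1, so `v` and `v₁` are dependent modulo `L`; pairing the relation
  -- with `q` removes `v₁`.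
  have hdep : ¬ LinearIndependent ℤ ![L.mkQ v, L.mkQ v₁] := fun h => by
    have h2 := h.fintype_card_le_finrank
    rw [Fintype.card_fin] at h2
    omega
  rw [LinearIndependent.pair_iff] at hdep
  push Not at hdep
  obtain ⟨a, b, hab, hne⟩ := hdep
  have hmem : a • v + b • v₁ ∈ L := by
    rw [← map_smul, ← map_smul, ← map_add] at hab
    exact (Submodule.Quotient.mk_eq_zero L).1 hab
  have hb := hLq _ hmem
  rw [dotProduct_add, dotProduct_smul, dotProduct_smul, hv, hv₁] at hb
  have hb0 : b = 0 := by simpa using hb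
  subst hb0
  rw [zero_smul, add_zero] at hmem
  have ha : a ≠ 0 := fun h => hne h rfl
  refine ⟨a.natAbs, Int.natAbs_pos.2 ha, ?_⟩
  rcases Int.natAbs_eq a with h | h
  · rwa [← h]
  · rw [show (a.natAbs : ℤ) = -a by omega, neg_smul]
    exact L.neg_mem hmem

/-- A wave does not shift a state along the hyperplane. -/
theorem eq_of_wave_of_orthogonal {n : ℕ} {q v₁ v : Lattice n} (hv₁ : q ⬝ᵥ v₁ = 1)
    (hv : q ⬝ᵥ v = 0) {σ u : Lattice n → ℤ} {c : ℕ}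
    (hc : ∀ z, ↑c ≤ q ⬝ᵥ z ∨ q ⬝ᵥ z ≤ -c → σ z = 2 * (n : ℤ) - 1)
    (hσ : ∀ z, σ z ≤ 2 * (n : ℤ) - 1) (hu : ∀ z, u z = 0 ∨ u z = 1) {x₀ : Lattice n}
    (hx₀ : u x₀ = 1) (hstep : ∀ z, σ (z + v) = σ z + laplacian u z) {N : ℕ} (hN : 0 < N)
    (hper : ∀ z, σ (z + (N : ℤ) • v) = σ z) (z : Lattice n) : σ z = σ (z + v) := by
  have hnn : ∀ z, 0 ≤ u z ∧ u z ≤ 1 := fun z => by rcases hu z with h | h <;> omega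
  -- Over a full period the Laplacian telescopes to 0, so `f` is constant, equal to 0 or `N` by its
  -- value far left. The first contradicts `u x₀ = 1`; the second means that `u` is identically 1.
  set f : Lattice n → ℤ := fun z => ∑ j ∈ Finset.range N, u (z + (j : ℤ) • v) with hf
  have hlap : ∀ z, laplacian f z = 0 := fun z => by
    rw [hf, laplacian_sum]
    have h1 : ∀ j ∈ Finset.range N, laplacian (fun y => u (y + (j : ℤ) • v)) z =
        σ (z + ((j + 1 : ℕ) : ℤ) • v) - σ (z + (j : ℤ) • v) := fun j _ => by
      rw [laplacian_translate, eq_sub_iff_add_eq', ← hstep]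
      congr 1
      push_cast
      module
    rw [Finset.sum_congr rfl h1, Finset.sum_range_sub fun j : ℕ => σ (z + (j : ℤ) • v), hper]
    simp
  have hconst := superharmonic_const (fun z => (hlap z).le) (b := 0)
    fun z => Finset.sum_nonneg fun j _ => (hnn _).1
  set y : Lattice n := (-c : ℤ) • v₁ with hy
  have hyq : q ⬝ᵥ y = -c := by rw [hy, dotProduct_smul, hv₁, smul_eq_mul, mul_one]
  have hyj : ∀ j : ℤ, q ⬝ᵥ (y + j • v) ≤ -c := fun j => by
    rw [dotProduct_add_smul, hv, hyq]; omega
  have hall : ∀ z w, q ⬝ᵥ z ≤ -c → q ⬝ᵥ w ≤ -c → u z = 1 → u w = 1 := fun z w =>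
    eq_one_of_full_halfspace (fun z hz => hc z (Or.inr hz)) hu
      fun z => by rw [← hstep]; exact hσ _
  have hsingle : ∀ z, u z ≤ f z := fun z => by
    have := Finset.single_le_sum (f := fun j : ℕ => u (z + (j : ℤ) • v)) (fun j _ => (hnn _).1)
      (Finset.mem_range.2 hN)
    rwa [Nat.cast_zero, zero_smul, add_zero] at this
  rcases hu y with h0 | h0
  · have hfy : f y = 0 := Finset.sum_eq_zero fun j _ => (hu _).resolve_right fun h => by
      have := hall _ y (hyj j) hyq.le h
      omega
    have := hsingle x₀
    rw [hconst x₀ y] at this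
    omega
  · have hfy : f y = N := by
      have h1 : ∀ j ∈ Finset.range N, u (y + (j : ℤ) • v) = 1 := fun j _ =>
        hall y _ hyq.le (hyj j) h0
      rw [hf]
      simp only
      rw [Finset.sum_congr rfl h1]
      simp
    have h1 : ∀ z, u z = 1 := fun z => by
      refine (hu z).resolve_left fun hz => ?_
      have hlt : f z < ∑ j ∈ Finset.range N, 1 :=
        Finset.sum_lt_sum (fun j _ => (hnn _).2) ⟨0, Finset.mem_range.2 hN, by simp [hz]⟩
      rw [hconst z y, hfy] at hlt
      simp at hlt
    rw [hstep, show u = fun _ => 1 from funext h1, laplacian_const, add_zero]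

/-! ### The potential of a travelling state -/

/-- A function `F` with `F (z + v) = F z + s z` and `Δ F = σ - (2n - 1)`, when a wave with
indicator `s` up to a constant shifts `σ` by `v`. -/
theorem exists_potential {n : ℕ} {q v : Lattice n} (hv : 0 < q ⬝ᵥ v) {σ s : Lattice n → ℤ} {c : ℕ}
    (hc : ∀ z, ↑c ≤ q ⬝ᵥ z → σ z = 2 * (n : ℤ) - 1) (hs : ∀ z, ↑c ≤ q ⬝ᵥ z → s z = 0)
    (hstep : ∀ z, σ (z + v) = σ z + laplacian s z) :
    ∃ F : Lattice n → ℤ, (∀ z, F (z + v) = F z + s z) ∧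
      (∀ z, σ z = 2 * (n : ℤ) - 1 + laplacian F z) ∧
      ∀ z (N : ℕ), ↑c ≤ q ⬝ᵥ z + N → F z = -∑ j ∈ Finset.range N, s (z + (j : ℤ) • v) := by
  have hge : ∀ z (j : ℕ), q ⬝ᵥ z + j ≤ q ⬝ᵥ (z + (j : ℤ) • v) := fun z j => by
    rw [dotProduct_add_smul]
    nlinarith [Int.natCast_nonneg j]
  -- Minus the sum of `s` along the ray `z + j • v`, finite because `s` vanishes far to the right.
  set F : Lattice n → ℤ := fun z =>
    -∑ j ∈ Finset.range (c - q ⬝ᵥ z).toNat, s (z + (j : ℤ) • v) with hFdef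
  have hF : ∀ z (N : ℕ), ↑c ≤ q ⬝ᵥ z + N →
      F z = -∑ j ∈ Finset.range N, s (z + (j : ℤ) • v) := fun z N hN => by
    rw [hFdef]
    simp only
    rw [Finset.eventually_constant_sum (fun j hj => hs _ (le_trans (by omega) (hge z j)))
      (show (c - q ⬝ᵥ z).toNat ≤ N by omega)]
  refine ⟨F, fun z => ?_, fun z => ?_, hF⟩
  · have hN : (c : ℤ) ≤ q ⬝ᵥ z + (c + (q ⬝ᵥ z).natAbs : ℕ) := by omega
    rw [hF z (c + (q ⬝ᵥ z).natAbs + 1) (by omega), hF (z + v) (c + (q ⬝ᵥ z).natAbs) (by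
      rw [dotProduct_add]; omega), Finset.sum_range_succ']
    have h1 : ∀ j : ℕ, z + ((j + 1 : ℕ) : ℤ) • v = z + v + (j : ℤ) • v := fun j => by
      push_cast
      module
    simp only [h1]
    rw [Nat.cast_zero, zero_smul, add_zero]
    ring
  · obtain ⟨M, hM⟩ := Int.eq_ofNat_of_zero_le (a := ∑ j, |q j|)
      (Finset.sum_nonneg fun _ _ => abs_nonneg _)
    set N := c + (q ⬝ᵥ z).natAbs + M with hN
    have hlap : laplacian F z =
        laplacian (fun y => (-1) * ∑ j ∈ Finset.range N, s (y + (j : ℤ) • v)) z := by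
      refine laplacian_congr ?_ fun i => ?_
      · rw [hF z N (by omega), neg_one_mul]
      · have := abs_le.1 (abs_le_sum_abs q i)
        rw [hF _ N (by rw [dotProduct_add, dotProduct_single_one']; omega),
          hF _ N (by rw [dotProduct_sub, dotProduct_single_one']; omega), neg_one_mul, neg_one_mul]
        exact ⟨rfl, rfl⟩
    have h1 : ∀ j ∈ Finset.range N, laplacian (fun y => s (y + (j : ℤ) • v)) z =
        σ (z + ((j + 1 : ℕ) : ℤ) • v) - σ (z + (j : ℤ) • v) := fun j _ => by
      rw [laplacian_translate, eq_sub_iff_add_eq', ← hstep]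
      congr 1
      push_cast
      module
    rw [hlap, laplacian_const_mul, laplacian_sum, Finset.sum_congr rfl h1,
      Finset.sum_range_sub fun j : ℕ => σ (z + (j : ℤ) • v), hc _ (le_trans (by omega) (hge z N)),
      Nat.cast_zero, zero_smul, add_zero]
    ring

/-- If `F` behaves far to the left like a function with slope `b / (q ⬝ᵥ v)`, the difference is
bounded below to the left. -/
theorem exists_lower_bound {n : ℕ} {q v : Lattice n} (hv : 0 < q ⬝ᵥ v) {F s : Lattice n → ℤ}
    {c : ℕ} {b : ℤ} (hb : b = 0 ∨ b = 1) (hs : ∀ z, s z ≤ 1)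
    (hsb : ∀ z, q ⬝ᵥ z ≤ -c → s z = b) (hstep : ∀ z, F (z + v) = F z + s z)
    (hF : ∀ z (N : ℕ), ↑c ≤ q ⬝ᵥ z + N → F z = -∑ j ∈ Finset.range N, s (z + (j : ℤ) • v)) :
    ∃ l : ℤ, ∀ z, q ⬝ᵥ z ≤ c + q ⬝ᵥ v → l ≤ (q ⬝ᵥ v) * F z - b * (q ⬝ᵥ z) := by
  set m := q ⬝ᵥ v
  -- On the strip around the origin `F` is at least `-2c`. Further left, a step by `-v` lowers both
  -- `m * F z` and `b * (q ⬝ᵥ z)` by `m * b`.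
  have key : ∀ k : ℕ, ∀ z, q ⬝ᵥ z ≤ c + m → -c - k ≤ q ⬝ᵥ z →
      m * (-(2 * c)) - (c + m) ≤ m * F z - b * (q ⬝ᵥ z) := by
    intro k
    have base : ∀ z, q ⬝ᵥ z ≤ c + m → -c ≤ q ⬝ᵥ z →
        m * (-(2 * c)) - (c + m) ≤ m * F z - b * (q ⬝ᵥ z) := fun z h1 h2 => by
      have h3 : -(2 * (c : ℤ)) ≤ F z := by
        rw [hF z (2 * c) (by push_cast; linarith)]
        have := Finset.sum_le_card_nsmul (Finset.range (2 * c)) (fun j : ℕ => s (z + (j : ℤ) • v)) 1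
          fun j _ => hs _
        rw [Finset.card_range, nsmul_eq_mul, mul_one] at this
        push_cast at this
        linarith
      have h4 := mul_le_mul_of_nonneg_left h3 hv.le
      rcases hb with rfl | rfl <;> linarith [Int.natCast_nonneg c]
    induction k with
    | zero => exact fun z h1 h2 => base z h1 (by simpa using h2)
    | succ k ih =>
      intro z h1 h2
      by_cases h : -c ≤ q ⬝ᵥ z
      · exact base z h1 h
      · have h3 : q ⬝ᵥ (z + v) = q ⬝ᵥ z + m := dotProduct_add _ _ _
        have h4 := ih (z + v) (by omega) (by push_cast at h2; omega)
        rw [hstep, hsb z (by omega), h3] at h4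
        linarith
  exact ⟨_, fun z hz => key (c + (q ⬝ᵥ z).natAbs) z hz (by omega)⟩

/-- A wave that shifts a hyperplane-shaped state across the hyperplane shifts a translate of the
state defined by the canonical husking. -/
theorem IsLeastProfile.exists_translate {n : ℕ} {q v₁ v : Lattice n} (hq : IsPrimitive q)
    (hv₁ : q ⬝ᵥ v₁ = 1) {g : ℤ → ℤ} (hg : IsLeastProfile q g) (hv : 0 < q ⬝ᵥ v)
    {σ u : Lattice n → ℤ} {c : ℕ}
    (hc : ∀ z, ↑c ≤ q ⬝ᵥ z ∨ q ⬝ᵥ z ≤ -c → σ z = 2 * (n : ℤ) - 1)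
    (hσ : ∀ z, σ z ≤ 2 * (n : ℤ) - 1) (hu : ∀ z, u z = 0 ∨ u z = 1) {x₀ : Lattice n}
    (hσx₀ : σ x₀ = 2 * (n : ℤ) - 1)
    (hstep : ∀ z, σ (z + v) = σ z + laplacian u z)
    (hmin : ∀ w : Lattice n → ℤ, (∀ z, 0 ≤ w z) → 1 ≤ w x₀ →
        (∀ z, σ z + laplacian w z ≤ 2 * (n : ℤ) - 1) → ∀ z, u z ≤ w z)
    (hne : ¬ ∀ z, σ z = σ (z + v)) :
    ∃ w : Lattice n, ∀ z, σ z = 2 * (n : ℤ) - 1 + lineLaplacian q g (q ⬝ᵥ (z + w)) := by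
  have hsurj : ∀ t : ℤ, q ⬝ᵥ (t • v₁) = t := fun t => by
    rw [dotProduct_smul, hv₁, smul_eq_mul, mul_one]
  have hustab : ∀ z, σ z + laplacian u z ≤ 2 * (n : ℤ) - 1 := fun z => by
    rw [← hstep]; exact hσ _
  have side : ∀ p : Lattice n, (∀ z, p ⬝ᵥ z ≤ -c → σ z = 2 * (n : ℤ) - 1) →
      (∃ y, p ⬝ᵥ y ≤ -c) → ∃ a, (a = 0 ∨ a = 1) ∧ ∀ z, p ⬝ᵥ z ≤ -c → u z = a := by
    rintro p hp ⟨y, hy⟩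
    refine ⟨u y, hu y, fun z hz => ?_⟩
    have h1 := eq_one_of_full_halfspace hp hu hustab hy hz
    have h2 := eq_one_of_full_halfspace hp hu hustab hz hy
    rcases hu y with h | h <;> rcases hu z with h' | h' <;> simp_all
  obtain ⟨b, hb, hub⟩ := side q (fun z hz => hc z (Or.inr hz)) ⟨(-c : ℤ) • v₁, (hsurj _).le⟩
  obtain ⟨a, ha, hua'⟩ := side (-q) (fun z hz => hc z (Or.inl (by
    rw [neg_dotProduct] at hz; linarith))) ⟨(c : ℤ) • v₁, by rw [neg_dotProduct, hsurj]⟩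
  have hua : ∀ z, ↑c ≤ q ⬝ᵥ z → u z = a := fun z hz => hua' z (by
    rw [neg_dotProduct]; linarith)
  obtain ⟨F, hFv, hFlap, hFsum⟩ := exists_potential hv (σ := σ) (s := fun z => u z - a)
    (fun z hz => hc z (Or.inl hz)) (fun z hz => by rw [hua z hz, sub_self])
    (fun z => by rw [laplacian_sub, laplacian_const, sub_zero]; exact hstep z)
  have hFsup : ∀ z, laplacian F z ≤ 0 := fun z => by linarith [hσ z, hFlap z]
  -- A superharmonic `F` bounded below is constant, which makes `σ` constant. This excludes `a = 1`
  -- and, below, `b = 0`.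
  have hunbdd : ∀ l : ℤ, ¬ ∀ z, l ≤ F z := fun l hl => hne fun z => by
    have hconst : F = fun _ => F 0 := funext fun z => superharmonic_const hFsup hl z 0
    rw [hFlap, hFlap (z + v), hconst, laplacian_const, laplacian_const]
  have ha0 : a = 0 := by
    refine ha.resolve_right fun ha1 => hunbdd 0 fun z => ?_
    rw [hFsum z (c + (q ⬝ᵥ z).natAbs) (by omega), neg_nonneg]
    exact Finset.sum_nonpos fun j _ => by
      rcases hu (z + (j : ℤ) • v) with h | h <;> omega
  subst ha0
  simp only [sub_zero] at hFv hFsum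
  have hF0 : ∀ z, ↑c ≤ q ⬝ᵥ z → F z = 0 := fun z hz => by
    simpa using hFsum z 0 (by simpa using hz)
  have hFnonpos : ∀ z, F z ≤ 0 := fun z => by
    rw [hFsum z (c + (q ⬝ᵥ z).natAbs) (by omega), neg_nonpos]
    exact Finset.sum_nonneg fun j _ => by
      rcases hu (z + (j : ℤ) • v) with h | h <;> omega
  obtain ⟨l, hl⟩ := exists_lower_bound hv hb
    (fun z => by rcases hu z with h | h <;> omega) hub hFv hFsum
  have hb1 : b = 1 := by
    refine hb.resolve_left fun hb0 => hunbdd (min 0 l) fun z => ?_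
    rcases le_total (c : ℤ) (q ⬝ᵥ z) with h | h
    · rw [hF0 z h]; exact min_le_left _ _
    · have h1 := hl z (by omega)
      rw [hb0, zero_mul, sub_zero] at h1
      have h2 := hFnonpos z
      have h3 : (q ⬝ᵥ v) * F z ≤ F z := by nlinarith
      exact (min_le_right _ _).trans (h1.trans h3)
  subst hb1
  simp only [one_mul] at hl
  set m := q ⬝ᵥ v with hm
  obtain ⟨M, hM⟩ := Int.eq_ofNat_of_zero_le (a := ∑ j, |q j|)
    (Finset.sum_nonneg fun _ _ => abs_nonneg _)
  have hnbr : ∀ i, -(M : ℤ) ≤ q i ∧ q i ≤ M := fun i => abs_le.1 (hM ▸ abs_le_sum_abs q i)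
  -- The minimum over the left half-space persists along `-v`. It is thus attained in the half-space
  -- retracted by `M`, whose points have all neighbours in the original one, so the minimum
  -- principle applies.
  obtain ⟨μ, hμ⟩ : ∃ μ, ∀ z, q ⬝ᵥ z ≤ -c - M → m * F z - q ⬝ᵥ z = μ := by
    obtain ⟨y, hy, hymin⟩ := exists_minimizer (s := {z | q ⬝ᵥ z ≤ -c})
      (F := fun z => m * F z - q ⬝ᵥ z) ⟨(-c : ℤ) • v₁, (hsurj _).le⟩ (b := l)
      (fun z hz => hl z (by have : q ⬝ᵥ z ≤ -c := hz; omega))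
    have hy : q ⬝ᵥ y ≤ -c := hy
    have hshift : ∀ k : ℕ, m * F (y + (-k : ℤ) • v) - q ⬝ᵥ (y + (-k : ℤ) • v) =
        m * F y - q ⬝ᵥ y := by
      intro k
      induction k with
      | zero => simp
      | succ k ih =>
        have h1 := hFv (y + (-(k + 1 : ℕ) : ℤ) • v)
        rw [hub _ (by rw [dotProduct_add_smul]; nlinarith [Int.natCast_nonneg (k + 1)]),
          show y + (-(k + 1 : ℕ) : ℤ) • v + v = y + (-k : ℤ) • v by push_cast; module] at h1
        rw [← ih, h1]
        simp only [dotProduct_add_smul, ← hm]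
        push_cast
        ring
    refine ⟨m * F y - q ⬝ᵥ y, fun z hz => ?_⟩
    refine eq_min_of_superharmonic (q := q) (c := -c - M) (F := fun z => m * F z - q ⬝ᵥ z)
      (fun z hz => ?_) (fun z i hz => ⟨hymin _ ?_, hymin _ ?_⟩) (z₀ := y + (-M : ℤ) • v) ?_
      (hshift M) hz
    · rw [laplacian_sub, laplacian_const_mul, laplacian_dotProduct, sub_zero]
      have h1 := hFlap z
      rw [hc z (by omega)] at h1
      rw [show laplacian F z = 0 by linarith, mul_zero]
    · change q ⬝ᵥ _ ≤ -(c : ℤ)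
      rw [dotProduct_add, dotProduct_single_one']
      linarith [(hnbr i).2]
    · change q ⬝ᵥ _ ≤ -(c : ℤ)
      rw [dotProduct_sub, dotProduct_single_one']
      linarith [(hnbr i).1]
    · rw [dotProduct_add_smul]
      nlinarith [Int.natCast_nonneg M]
  -- Far to the left the integer differences of `F` are `q i / m`, so `m` divides `q`.
  have hm1 : m = 1 := by
    by_contra hm1
    refine hq ⟨m, fun i => F ((-c - 2 * M : ℤ) • v₁ + Pi.single i 1) - F ((-c - 2 * M : ℤ) • v₁),
      by omega, ?_⟩
    funext i
    have h1 := hμ ((-c - 2 * M : ℤ) • v₁ + Pi.single i 1) (by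
      rw [dotProduct_add, hsurj, dotProduct_single_one']; linarith [(hnbr i).2])
    have h2 := hμ ((-c - 2 * M : ℤ) • v₁) (by rw [hsurj]; linarith [Int.natCast_nonneg M])
    rw [dotProduct_add, dotProduct_single_one'] at h1
    rw [Pi.smul_apply, smul_eq_mul]
    linarith
  rw [hm1] at hμ hl
  simp only [one_mul] at hμ hl
  have hback : ∀ (N : ℕ) z, F z ≤ F (z + (-N : ℤ) • v) + N := by
    intro N
    induction N with
    | zero => simp
    | succ N ih =>
      intro z
      have h1 := ih z
      have h2 := hFv (z + (-(N + 1 : ℕ) : ℤ) • v)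
      rw [show z + (-(N + 1 : ℕ) : ℤ) • v + v = z + (-N : ℤ) • v by push_cast; module] at h2
      have h3 := hu (z + (-(N + 1 : ℕ) : ℤ) • v)
      push_cast at h2 h3 ⊢
      omega
  have hFle : ∀ z, F z ≤ q ⬝ᵥ z + μ := fun z => by
    set N := c + M + (q ⬝ᵥ z).natAbs
    have h1 := hback N z
    have h2 : q ⬝ᵥ (z + (-N : ℤ) • v) = q ⬝ᵥ z - N := by
      rw [dotProduct_add_smul, ← hm, hm1]; ring
    have h3 := hμ (z + (-N : ℤ) • v) (by rw [h2]; omega)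
    rw [h2] at h3
    linarith
  have hdot : ∀ z, q ⬝ᵥ (z + (-μ) • v) = q ⬝ᵥ z - μ := fun z => by
    rw [dotProduct_add_smul, ← hm, hm1]; ring
  have hcancel : ∀ z, z + μ • v + (-μ) • v = z := fun z => by module
  have hcancel' : ∀ z, z + (-μ) • v + μ • v = z := fun z => by module
  have hcomm : ∀ z, z + v + (-μ) • v = z + (-μ) • v + v := fun z => by module
  have key := hg.eq_of_wave (v := v) (by rw [← hm, hm1]) (F := fun z => F (z + (-μ) • v))
    (k := μ.natAbs + l.natAbs) (K := c + M + μ.natAbs) (x₀ := x₀ + μ • v)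
    (fun z => by rw [laplacian_translate]; exact hFsup _)
    (fun z => by
      have h1 := hFnonpos (z + (-μ) • v)
      have h2 := hFle (z + (-μ) • v)
      rw [hdot] at h2
      exact le_min h1 (by linarith))
    (fun z => by
      rcases le_total (c : ℤ) (q ⬝ᵥ z - μ) with h | h
      · rw [hF0 _ (by rw [hdot]; exact h)]
        omega
      · have h1 := hl (z + (-μ) • v) (by rw [hdot]; omega)
        rw [hdot] at h1
        omega)
    (fun z hz => by
      rcases hz with hz | hz
      · rw [hF0 _ (by rw [hdot]; omega)]
        omega
      · have h1 := hμ (z + (-μ) • v) (by rw [hdot]; omega)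
        rw [hdot] at h1
        omega)
    (fun z => by
      have h1 := hu (z + (-μ) • v)
      rw [hcomm, hFv]
      omega)
    (by
      rw [laplacian_translate, hcancel]
      linarith [hFlap x₀])
    (fun G hG hFG hx z => by
      rw [hcancel] at hx
      have h1 := hmin (fun y => G (y + μ • v) - F y)
        (fun y => by have := hFG (y + μ • v); rw [hcancel] at this; linarith)
        (by linarith)
        (fun y => by
          rw [laplacian_sub, laplacian_translate]
          linarith [hG (y + μ • v), hFlap y]) (z + (-μ) • v)
      simp only [hcancel'] at h1
      rw [hcomm, hFv]
      linarith)
  refine ⟨μ • v, fun z => ?_⟩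
  rw [hFlap, ← laplacian_comp_dotProduct, ← laplacian_translate]
  congr 2
  funext y
  have := key (y + μ • v)
  rwa [hcancel] at this

theorem IsLeastProfile.exists_translate_of_isSoliton {n : ℕ} {q v₁ : Lattice n}
    (hq : IsPrimitive q) (hv₁ : q ⬝ᵥ v₁ = 1) {g : ℤ → ℤ} (hg : IsLeastProfile q g)
    {φ : Lattice n → ℕ} (hφ : IsSoliton q φ) :
    ∃ w : Lattice n, ∀ z, (φ z : ℤ) = 2 * (n : ℤ) - 1 + lineLaplacian q g (q ⬝ᵥ (z + w)) := by
  obtain ⟨⟨L, hLrank, hL⟩, ⟨c₁, c₂, hc⟩, v, -, ⟨x₀, hx₀, -, hrel⟩, hne⟩ := hφ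
  set σ : Lattice n → ℤ := fun z => φ z with hσdef
  -- The final configuration of the relaxation is a translate of `φ`, so its bound holds for `φ`.
  have hσ : ∀ z, σ z ≤ 2 * (n : ℤ) - 1 := fun z => by
    obtain ⟨-, -, -, h⟩ := hrel
    have := h (z + -v)
    simp only [neg_add_cancel_right] at this
    exact this
  have hneσ : ¬ ∀ z, σ z = σ (z + v) := fun h => hne fun z => by
    have := h z
    simp only [hσdef] at this
    exact_mod_cast this
  obtain ⟨u, hu, hux₀, hstep, hmin⟩ := exists_wave_set hσ hrel
  have hcσ : ∀ z, ↑(c₁.natAbs + c₂.natAbs + 1) ≤ q ⬝ᵥ z ∨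
      q ⬝ᵥ z ≤ -↑(c₁.natAbs + c₂.natAbs + 1) → σ z = 2 * (n : ℤ) - 1 := fun z hz => by
    by_contra h
    have := hc z h
    omega
  rcases lt_trichotomy (q ⬝ᵥ v) 0 with hv | hv | hv
  · have hq' : IsPrimitive (-q) := by
      rintro ⟨k, q', hk, h⟩
      exact hq ⟨k, -q', hk, by rw [smul_neg, ← h, neg_neg]⟩
    obtain ⟨w, hw⟩ := hg.neg.exists_translate hq' (v₁ := -v₁) (v := v)
      (by rw [neg_dotProduct_neg, hv₁]) (by rw [neg_dotProduct]; linarith)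
      (c := c₁.natAbs + c₂.natAbs + 1)
      (fun z hz => hcσ z (by rw [neg_dotProduct] at hz; omega)) hσ hu hx₀ hstep hmin hneσ
    refine ⟨w, fun z => ?_⟩
    have := hw z
    rwa [lineLaplacian_neg, neg_dotProduct, hg.lineLaplacian_symm] at this
  · exfalso
    obtain ⟨y, hy⟩ : ∃ y, σ y ≠ 2 * (n : ℤ) - 1 := by
      by_contra! h
      exact hneσ fun z => by rw [h, h]
    have hLq : ∀ p ∈ L, q ⬝ᵥ p = 0 := fun p hp => by
      by_contra hne0
      -- The factor `q ⬝ᵥ p` makes the displacement of `q ⬝ᵥ y` a positive multiple of a square,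
      -- large enough to leave the strip.
      have h1 := hc (y + (2 * (c₁.natAbs + c₂.natAbs + 1 + (q ⬝ᵥ y).natAbs) * (q ⬝ᵥ p) : ℤ) • p)
        (by rw [← hL y _ (L.smul_mem _ hp)]; exact hy)
      rw [dotProduct_add_smul] at h1
      have h2 : 1 ≤ (q ⬝ᵥ p) * (q ⬝ᵥ p) := by
        have := mul_self_pos.2 hne0
        omega
      rw [mul_assoc] at h1
      have h3 : (0 : ℤ) ≤ c₁.natAbs + c₂.natAbs + 1 + (q ⬝ᵥ y).natAbs := by omega
      have h4 := mul_le_mul_of_nonneg_left h2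
        (show (0 : ℤ) ≤ 2 * (c₁.natAbs + c₂.natAbs + 1 + (q ⬝ᵥ y).natAbs) by omega)
      omega
    obtain ⟨N, hN, hNL⟩ := exists_smul_mem hv₁ hv hLrank hLq
    exact hneσ (eq_of_wave_of_orthogonal hv₁ hv hcσ hσ hu hux₀ hstep hN fun z => by
      simp only [hσdef]
      exact_mod_cast (hL z _ hNL).symm)
  · exact hg.exists_translate hq hv₁ hv hcσ hσ hu hx₀ hstep hmin hneσ

end Sandpile

theorem theorem1p3 (n : ℕ) (q : Sandpile.Lattice n) (hq : Sandpile.IsPrimitive q) :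
    ∃ (ψ : Sandpile.Lattice n → ℤ) (φ : Sandpile.Lattice n → ℕ),
      Sandpile.IsCanonicalHusking (fun z => min 0 (q ⬝ᵥ z)) ψ ∧
      (∀ z, (φ z : ℤ) = 2 * n - 1 + Sandpile.laplacian ψ z) ∧
      Sandpile.IsSoliton q φ ∧
      (∀ v : Sandpile.Lattice n, q ⬝ᵥ v = 1 →
        Sandpile.IsMovableBy v φ ∧ Sandpile.IsMovableBy (-v) φ) ∧
      (∀ φ' : Sandpile.Lattice n → ℕ, Sandpile.IsSoliton q φ' →
        ∃ w : Sandpile.Lattice n, ∀ z, φ' z = φ (z + w)) := by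
  obtain ⟨v₁, hv₁⟩ := hq.exists_dotProduct_eq_one
  obtain ⟨g, hg⟩ := Sandpile.exists_least_profile hv₁
  have hψ := hg.isCanonicalHusking hv₁
  have hφ' : ∀ z, ((2 * (n : ℤ) - 1 + Sandpile.laplacian (fun z => g (q ⬝ᵥ z)) z).toNat : ℤ) =
      2 * n - 1 + Sandpile.laplacian (fun z => g (q ⬝ᵥ z)) z :=
    fun z => Int.toNat_of_nonneg (hψ.state_nonneg hv₁ z)
  have hφ : ∀ z, ((2 * (n : ℤ) - 1 + Sandpile.laplacian (fun z => g (q ⬝ᵥ z)) z).toNat : ℤ) =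
      2 * n - 1 + Sandpile.lineLaplacian q g (q ⬝ᵥ z) := fun z => by
    rw [hφ', Sandpile.laplacian_comp_dotProduct]
  refine ⟨_, _, hψ, hφ', hg.isSoliton hv₁ hφ, fun v hv => ⟨hg.isMovableBy hv hφ, ?_⟩,
    fun φ' hs => ?_⟩
  -- The same `g` serves `-q`, and the symmetry of its Laplacian gives back the same state.
  · refine hg.neg.isMovableBy (by rw [neg_dotProduct_neg, hv]) fun z => ?_
    rw [hφ, Sandpile.lineLaplacian_neg, neg_dotProduct, hg.lineLaplacian_symm]
  · obtain ⟨w, hw⟩ := hg.exists_translate_of_isSoliton hq hv₁ hs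
    refine ⟨w, fun z => ?_⟩
    have h1 := hw z
    rw [← hφ (z + w)] at h1
    exact_mod_cast h1
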